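/- Let $n\ge 1$, let $\lambda=(\lambda_1\ge\lambda_2\ge\cdots\ge\lambda_n\ge 0)$ be a partition of length at most $n$, let $\delta=(n,n-1,\ldots,1)$, and let $\mu=\lambda+\delta$, a strict partition of length $n$. The Young diagram $F^\lambda$ has rows of lengths $\lambda_1,\ldots,\lambda_n$ starting in column $1$; the shifted diagram $SF^\mu$ has its $i$th row of length $\mu_i$ starting in column $i$. Let $\mathcal T^\lambda(n,\overline n)$ be the set of King symplectic tableaux $T$ of shape $\lambda$: fillings of $F^\lambda$ with entries from $\overline 1<1<\overline 2<2<\cdots<\overline n<n$, weakly increasing along rows from left to right, strictly increasing down columns, and such that $k$ and $\overline k$ appear no lower than the $k$th row. Put $\mathrm{wgt}(T)=(w_1,\ldots,w_n)$ with $w_k=n_k-n_{\overline k}$, where $n_a$ is the number of entries equal to $a$. Let $\mathcal{QST}^\mu(n,\overline n)$ be the set of fillings $QST$ of $SF^\mu$ with entries from $$\overline 1'<\overline 1<1'<1<\overline 2'<\overline 2<2'<2<\cdots<\overline n'<\overline n<n'<n,$$ weakly increasing along rows from left to right and down columns from top to bottom, with no two identical unprimed entries in any column, no two identical primed entries in any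 row, and with $k$th main diagonal entry in $\{\overline k',\overline k,k',k\}$ for every $k$. Let $\mathcal{QD}^\delta(n,\overline n)$ be the set of fillings $QD$ of $SF^\delta$ with entries from the same primed alphabet such that each unprimed entry $k$ or $\overline k$ appears only in the $k$th row and each primed entry $k'$ or $\overline k'$ appears only in the $k$th column. For $QST$ and $QD$ the weight is $({\bf u}/{\bf v})$, where $u_k=n_k-n_{\overline k}$ and $v_k=n_{k'}-n_{\overline k'}$ for $k=1,\ldots,n$; a weight ${\bf w}$ of a tableau $T$ is identified with $({\bf w}/{\bf 0})$. For every tableau, $\mathrm{bar}$ denotes the total number of barred entries (primed or not). Then there exists a bijection $$\Phi:\ \mathcal{QST}^\mu(n,\overline n)\longrightarrow \mathcal{QD}^\delta(n,\overline n)\times\mathcal T^\lambda(n,\overline n),\qquad QST\mapsto(QD,T),$$ such that, for all $QST\in\mathcal{QST}^\mu(n,\overline n)$, $$\mathrm{wgt}(QST)=\mathrm{wgt}(QD)+\mathrm{wgt}(T)\quad\text{and}\quad \mathrm{bar}(QST)=\mathrm{bar}(QD)+\mathrm{bar}(T).$$ -/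

import Mathlib

namespace SymplecticTableaux

/-! Rows, columns and letters are numbered from `0`: the row, column or letter that is usually
numbered `k` is here the one numbered `k - 1`. A cell is a pair (row, column). -/

/-- The letters `k` and `k̄` for `k : Fin n`. -/
@[ext]
structure Letter (n : ℕ) where
  index : Fin n
  barred : Bool
deriving DecidableEq

/-- The letters `k`, `k̄`, `k'` and `k̄'` for `k : Fin n`. -/
@[ext]
structure PrimedLetter (n : ℕ) where
  index : Fin n
  barred : Bool
  primed : Bool
deriving DecidableEq

/-- The position of a letter in the list `1̄, 1, 2̄, 2, …, n̄, n`. -/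
def Letter.rank {n : ℕ} (a : Letter n) : ℕ :=
  2 * (a.index : ℕ) + (if a.barred then 0 else 1)

/-- The position of a letter in the list `1̄', 1̄, 1', 1, 2̄', 2̄, 2', 2, …, n̄', n̄, n', n`. -/
def PrimedLetter.rank {n : ℕ} (a : PrimedLetter n) : ℕ :=
  4 * (a.index : ℕ) + (if a.barred then 0 else 2) + (if a.primed then 0 else 1)

theorem Letter.rank_injective {n : ℕ} : Function.Injective (Letter.rank (n := n)) := by
  rintro ⟨i, b⟩ ⟨j, c⟩ h
  cases b <;> cases c <;> simp [Letter.rank] at h ⊢ <;> omega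

theorem PrimedLetter.rank_injective {n : ℕ} :
    Function.Injective (PrimedLetter.rank (n := n)) := by
  rintro ⟨i, b, p⟩ ⟨j, c, q⟩ h
  cases b <;> cases c <;> cases p <;> cases q <;> simp [PrimedLetter.rank] at h ⊢ <;> omega

/-- The total order `1̄ < 1 < 2̄ < 2 < ⋯ < n̄ < n`. -/
instance Letter.instLinearOrder (n : ℕ) : LinearOrder (Letter n) :=
  LinearOrder.lift' Letter.rank Letter.rank_injective

/-- The total order `1̄' < 1̄ < 1' < 1 < 2̄' < 2̄ < 2' < 2 < ⋯ < n̄' < n̄ < n' < n`. -/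
instance PrimedLetter.instLinearOrder (n : ℕ) : LinearOrder (PrimedLetter n) :=
  LinearOrder.lift' PrimedLetter.rank PrimedLetter.rank_injective

/-- The staircase partition `δ = (n, n - 1, …, 1)`. -/
def staircase (n : ℕ) : Fin n → ℕ := fun i => n - (i : ℕ)

/-- The Young diagram of `lam = (lam 0, …, lam (n - 1))`: row `i` consists of the columns
`0, …, lam i - 1`. -/
def diagram {n : ℕ} (lam : Fin n → ℕ) : Finset (ℕ × ℕ) :=
  Finset.univ.biUnion fun i : Fin n =>
    (Finset.range (lam i)).image fun j => ((i : ℕ), j)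

/-- The shifted Young diagram of `mu = (mu 0, …, mu (n - 1))`: row `i` consists of the columns
`i, …, i + mu i - 1`. -/
def shiftedDiagram {n : ℕ} (mu : Fin n → ℕ) : Finset (ℕ × ℕ) :=
  Finset.univ.biUnion fun i : Fin n =>
    (Finset.Ico (i : ℕ) ((i : ℕ) + mu i)).image fun j => ((i : ℕ), j)

/-- A numbering of the cells of `D` is a symplectic tableau if its entries weakly increase along
rows and strictly increase down columns, and `k` and `k̄` occur no lower than row `k`. -/
structure IsSymplecticTableau {n : ℕ} {D : Finset (ℕ × ℕ)} (T : D → Letter n) : Prop where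
  row_weak : ∀ c d : D, c.1.1 = d.1.1 → c.1.2 < d.1.2 → T c ≤ T d
  col_strict : ∀ c d : D, c.1.2 = d.1.2 → c.1.1 < d.1.1 → T c < T d
  row_le_index : ∀ c : D, c.1.1 ≤ ((T c).index : ℕ)

/-- A numbering of the cells of the shifted diagram `D` is a primed shifted symplectic tableau if
its entries weakly increase along rows and down columns, no column has two identical unprimed
entries, no row has two identical primed entries, and the `k`th diagonal entry is one of
`k̄', k̄, k', k`. -/
structure IsPrimedShiftedSymplecticTableau {n : ℕ} {D : Finset (ℕ × ℕ)}
    (S : D → PrimedLetter n) : Prop where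
  row_weak : ∀ c d : D, c.1.1 = d.1.1 → c.1.2 < d.1.2 → S c ≤ S d
  col_weak : ∀ c d : D, c.1.2 = d.1.2 → c.1.1 < d.1.1 → S c ≤ S d
  col_unprimed : ∀ c d : D, c.1.2 = d.1.2 → c ≠ d → (S c).primed = false → S c ≠ S d
  row_primed : ∀ c d : D, c.1.1 = d.1.1 → c ≠ d → (S c).primed = true → S c ≠ S d
  diag : ∀ c : D, c.1.1 = c.1.2 → ((S c).index : ℕ) = c.1.1

/-- The set of symplectic tableaux of shape `lam` with entries `1̄, 1, …, n̄, n`. -/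
def T (n : ℕ) (lam : Fin n → ℕ) : Set (diagram lam → Letter n) :=
  {t | IsSymplecticTableau t}

/-- The set of primed shifted symplectic tableaux of shifted shape `mu` with primes allowed on the
main diagonal. -/
def QST (n : ℕ) (mu : Fin n → ℕ) : Set (shiftedDiagram mu → PrimedLetter n) :=
  {S | IsPrimedShiftedSymplecticTableau S}

/-- The set of primed numberings of the shifted staircase such that `k` and `k̄` occur only in row
`k`, and `k'` and `k̄'` occur only in column `k`. -/
def QD (n : ℕ) : Set (shiftedDiagram (staircase n) → PrimedLetter n) :=
  {P | ∀ c : shiftedDiagram (staircase n),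
    ((P c).primed = false → ((P c).index : ℕ) = c.1.1) ∧
    ((P c).primed = true → ((P c).index : ℕ) = c.1.2)}

/-- The number of cells with entry `a`. -/
def count {A : Type} [DecidableEq A] {D : Finset (ℕ × ℕ)} (f : D → A) (a : A) : ℕ :=
  (Finset.univ.filter fun c => f c = a).card

/-- The weight `w`, with `w k = n_k - n_k̄`. -/
def wgt {n : ℕ} {D : Finset (ℕ × ℕ)} (f : D → Letter n) : Fin n → ℤ :=
  fun k => (count f ⟨k, false⟩ : ℤ) - (count f ⟨k, true⟩ : ℤ)

/-- The weight `(u / v)`, with `u k = n_k - n_k̄` and `v k = n_k' - n_k̄'`. -/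
def primedWgt {n : ℕ} {D : Finset (ℕ × ℕ)} (f : D → PrimedLetter n) :
    (Fin n → ℤ) × (Fin n → ℤ) :=
  (fun k => (count f ⟨k, false, false⟩ : ℤ) - (count f ⟨k, true, false⟩ : ℤ),
   fun k => (count f ⟨k, false, true⟩ : ℤ) - (count f ⟨k, true, true⟩ : ℤ))

/-- The number of barred entries. -/
def bar {n : ℕ} {D : Finset (ℕ × ℕ)} (f : D → Letter n) : ℕ :=
  (Finset.univ.filter fun c => (f c).barred = true).card

/-- The number of barred entries, primed or not. -/
def primedBar {n : ℕ} {D : Finset (ℕ × ℕ)} (f : D → PrimedLetter n) : ℕ :=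
  (Finset.univ.filter fun c => (f c).barred = true).card

end SymplecticTableaux

namespace SymplecticTableaux

/-! No bijection is built by hand: both sides have the same generating function. Give the letters k,
k̄, k', k̄' commuting weights x_k, x̄_k, y_k, ȳ_k, subject only to x_k x̄_k = y_k ȳ_k = t for all k.
In the group algebra of weights and bar numbers a letter times its barred partner is always the same
element (weight zero, one bar), so the identity applies there. Comparing coefficients equates the
sizes of the fibres of the statistic, and arbitrary bijections between fibres are glued
(`exists_equiv_of_sum_single_eq`).

Both tableau sums are determinants of power series coefficients. The copies of the largest letter
form a horizontal strip if it is unprimed and a vertical strip if it is primed; summing over strips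
multiplies every series by 1/(1 - pX) or by 1 + qX (`sum_horizontalStrips`, `sum_verticalStrips`).
Hence column i of the determinant for QST comes from the product over k ≥ i of (1 + ȳ_k X)(1 + y_k
X) / ((1 - x̄_k X)(1 - x_k X)).

Put W = (1 + tX²)/X, X_k = x_k + x̄_k and Y_k = y_k + ȳ_k. The k-th factor is (W + Y_k)/(W - X_k),
and Newton interpolation at X_i, X_{i+1}, … writes the product as 1 plus a triangular combination of
X times the symplectic series, with diagonal coefficient ∏_{k ≥ i} (X_i + Y_k)
(`primedSeries_eq_sum`). The parts of μ are positive, so the summand 1 contributes nothing and the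
determinant factors (`coeffDet_primedSeries`). The product of all X_i + Y_k with i ≤ k is the
generating function of QD, whose cells are filled independently. -/

variable {R : Type*} [CommRing R]

/-! ### Determinants of coefficients and sums over strips -/

/-- The geometric series `1 + p u + p² u² + ⋯`. -/
def geom (p : R) : PowerSeries R := PowerSeries.mk fun n => p ^ n

theorem geom_mul_one_sub (p : R) : geom p * (1 - PowerSeries.C p * PowerSeries.X) = 1 := by
  ext n
  rw [mul_sub, mul_one, mul_comm (PowerSeries.C p), ← mul_assoc]
  rcases n with _ | n
  · simp [geom]
  · simp [geom, PowerSeries.coeff_succ_mul_X, PowerSeries.coeff_one, pow_succ]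

theorem coeff_mul_geom (φ : PowerSeries R) (p : R) (n : ℕ) :
    PowerSeries.coeff n (φ * geom p) =
      ∑ r ∈ Finset.range (n + 1), p ^ (n - r) * PowerSeries.coeff r φ := by
  rw [PowerSeries.coeff_mul, Finset.Nat.sum_antidiagonal_eq_sum_range_succ_mk]
  refine Finset.sum_congr rfl fun r _ => ?_
  simp [geom, mul_comm]

/-- The determinant whose entries are the coefficients of the series `Φ i` at the exponents
`a j`. -/
noncomputable def coeffDet {k : ℕ} (Φ : Fin k → PowerSeries R) (a : Fin k → ℕ) : R :=
  Matrix.det (Matrix.of fun j i => PowerSeries.coeff (a j) (Φ i))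

/-- The least values of the parts of a sequence that interlaces with `a`. -/
def lowerBound {m : ℕ} (a : Fin (m + 1) → ℕ) : Fin (m + 1) → ℕ :=
  Fin.snoc (α := fun _ => ℕ) (fun j : Fin m => a j.succ + 1) 0

/-- The sequences `ν` with `a 0 ≥ ν 0 > a 1 ≥ ν 1 > ⋯ > a m ≥ ν m ≥ 0`. -/
def horizontalStrips {m : ℕ} (a : Fin (m + 1) → ℕ) : Finset (Fin (m + 1) → ℕ) :=
  Fintype.piFinset fun j => Finset.Ico (lowerBound a j) (a j + 1)

open Classical in
/-- The strictly decreasing sequences `ν` with `a j - 1 ≤ ν j ≤ a j`. -/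
noncomputable def verticalStrips {m : ℕ} (a : Fin (m + 1) → ℕ) : Finset (Fin (m + 1) → ℕ) :=
  (Fintype.piFinset fun j => Finset.Icc (a j - 1) (a j)).filter StrictAnti

theorem det_eq_of_forall_row_eq_smul_add_succ {m : ℕ}
    (A B : Matrix (Fin (m + 1)) (Fin (m + 1)) R) (c : Fin m → R)
    (hlast : ∀ i, A (Fin.last m) i = B (Fin.last m) i)
    (h : ∀ (j : Fin m) i, A j.castSucc i = B j.castSucc i + c j * A j.succ i) :
    A.det = B.det := by
  rw [← Matrix.det_submatrix_equiv_self Fin.revPerm A,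
    ← Matrix.det_submatrix_equiv_self Fin.revPerm B]
  refine Matrix.det_eq_of_forall_row_eq_smul_add_pred (fun j => c j.rev) ?_ ?_
  · intro i
    simpa using hlast i.rev
  · intro j i
    simpa [Fin.rev_succ, Fin.rev_castSucc] using h j.rev i.rev

theorem det_sum_rows {k : ℕ} (A : Fin k → Finset ℕ) (c : Fin k → ℕ → R)
    (φ : Fin k → PowerSeries R) :
    ∑ ν ∈ Fintype.piFinset A, (∏ j, c j (ν j)) * coeffDet φ ν =
      Matrix.det (Matrix.of fun j i => ∑ r ∈ A j, c j r * PowerSeries.coeff r (φ i)) := by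
  have h := (Matrix.detRowAlternating (n := Fin k) (R := R)).toMultilinearMap.map_sum_finset
    (fun j r => c j r • fun i => PowerSeries.coeff r (φ i)) A
  have h2 : (fun j => ∑ r ∈ A j, c j r • fun i => PowerSeries.coeff r (φ i)) =
      Matrix.of fun j i => ∑ r ∈ A j, c j r * PowerSeries.coeff r (φ i) := by
    ext j i
    simp [Finset.sum_apply]
  rw [h2] at h
  refine Eq.trans ?_ h.symm
  refine Finset.sum_congr rfl fun ν _ => ?_
  rw [MultilinearMap.map_smul_univ]
  rfl

/-- Row j on the right sums over all r ≤ a j. Subtracting p ^ (a j - a (j + 1)) times the next row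
leaves exactly the r with a (j + 1) < r ≤ a j, and multilinearity in the rows then expands the
determinant over the interlacing sequences. -/
theorem sum_horizontalStrips {m : ℕ} (p : R) (Φ : Fin (m + 1) → PowerSeries R)
    {a : Fin (m + 1) → ℕ} (ha : StrictAnti a) :
    ∑ ν ∈ horizontalStrips a, (∏ j, p ^ (a j - ν j)) * coeffDet Φ ν =
      coeffDet (fun i => Φ i * geom p) a := by
  rw [horizontalStrips, det_sum_rows _ (fun j r => p ^ (a j - r)), coeffDet]
  symm
  refine det_eq_of_forall_row_eq_smul_add_succ _ _
    (fun j => p ^ (a j.castSucc - a j.succ)) ?_ ?_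
  · intro i
    simp only [Matrix.of_apply, coeff_mul_geom, lowerBound, Fin.snoc_last, Finset.range_eq_Ico]
  · intro j i
    have hlt : a j.succ < a j.castSucc := ha Fin.castSucc_lt_succ
    simp only [Matrix.of_apply, coeff_mul_geom, lowerBound, Fin.snoc_castSucc]
    rw [Finset.mul_sum, ← Finset.sum_range_add_sum_Ico _ (show a j.succ + 1 ≤ a j.castSucc + 1 by omega),
      add_comm]
    congr 1
    refine Finset.sum_congr rfl fun r hr => ?_
    rw [← mul_assoc, ← pow_add]
    congr 2
    have := Finset.mem_range.1 hr
    omega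

/-- Multilinearity alone yields all choices of ν j among a j and a j - 1; those that are not
strictly decreasing give two equal rows and vanish. -/
theorem sum_verticalStrips {m : ℕ} (q : R) (Φ : Fin (m + 1) → PowerSeries R)
    {a : Fin (m + 1) → ℕ} (ha : StrictAnti a) :
    ∑ ν ∈ verticalStrips a, (∏ j, q ^ (a j - ν j)) * coeffDet Φ ν =
      coeffDet (fun i => Φ i * (1 + PowerSeries.C q * PowerSeries.X)) a := by
  classical
  rw [verticalStrips, Finset.sum_filter_of_ne, det_sum_rows _ (fun j r => q ^ (a j - r)), coeffDet]
  · congr 1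
    ext j i
    simp only [Matrix.of_apply]
    rw [mul_add, mul_one, mul_comm (PowerSeries.C q), ← mul_assoc]
    -- For a j = 0 the truncated interval is the single point 0, in accordance with the vanishing
    -- constant term of a multiple of X.
    rcases a j with _ | r
    · simp
    · have : Finset.Icc (r + 1 - 1) (r + 1) = {r, r + 1} := by
        ext; simp; omega
      rw [this, Finset.sum_pair (by omega)]
      simp [PowerSeries.coeff_succ_mul_X, mul_comm, add_comm]
  · intro ν hν hne
    rw [Fintype.mem_piFinset] at hν
    by_contra hs
    have hlt : ∀ i j, i < j → ν j ≤ ν i := fun i j hij => by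
      have := ha hij
      have h1 := Finset.mem_Icc.1 (hν i)
      have h2 := Finset.mem_Icc.1 (hν j)
      omega
    have : ∃ i j, i < j ∧ ν i = ν j := by
      by_contra hcon
      push Not at hcon
      exact hs fun i j hij => lt_of_le_of_ne (hlt i j hij) (hcon i j hij).symm
    obtain ⟨i, j, hij, hv⟩ := this
    refine hne ?_
    rw [coeffDet, Matrix.det_zero_of_row_eq hij.ne, mul_zero]
    ext l
    simp [hv]

/-- The exponents decrease strictly, so only the last can be 0, and the column of the series 1 has
at most one nonzero entry, in the corner. This mirrors a last row that must be empty once the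
letters of the largest index are removed. -/
theorem coeffDet_snoc_one {m : ℕ} (Φ : Fin m → PowerSeries R) {a : Fin (m + 1) → ℕ}
    (ha : StrictAnti a) :
    coeffDet (Fin.snoc (α := fun _ => PowerSeries R) Φ 1) a =
      if a (Fin.last m) = 0 then coeffDet Φ (fun i => a i.castSucc) else 0 := by
  split_ifs with h
  · rw [coeffDet, Matrix.det_succ_column _ (Fin.last m), Finset.sum_eq_single (Fin.last m)]
    · simp only [Matrix.of_apply, Fin.snoc_last, h]
      rw [Even.neg_one_pow ⟨_, rfl⟩]
      simp only [Matrix.submatrix, Fin.succAbove_last, coeffDet]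
      simp
    · intro j _ hj
      have : a j ≠ 0 := by
        have := ha (Fin.lt_last_iff_ne_last.2 hj)
        omega
      simp [PowerSeries.coeff_one, this]
    · simp
  · refine Matrix.det_eq_zero_of_column_eq_zero (Fin.last m) fun j => ?_
    have : a j ≠ 0 := by
      have := ha.antitone (Fin.le_last j)
      omega
    simp [PowerSeries.coeff_one, this]

theorem coeffDet_X_mul {k : ℕ} (Φ : Fin k → PowerSeries R) {a : Fin k → ℕ} (ha : ∀ j, 0 < a j) :
    coeffDet (fun i => PowerSeries.X * Φ i) a = coeffDet Φ fun j => a j - 1 := by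
  rw [coeffDet, coeffDet]
  congr 1
  ext j i
  obtain ⟨r, hr⟩ : ∃ r, a j = r + 1 := ⟨a j - 1, by have := ha j; omega⟩
  simp [hr, PowerSeries.coeff_succ_X_mul]

/-! ### Generating functions of numberings and removal of the largest letter -/

/-- A numbering of `D` by natural numbers is admissible if it weakly increases along rows and down
columns, entries with `pr` do not repeat in a row, entries without `pr` do not repeat in a column,
and every entry is allowed in its cell. -/
structure IsAdmissible (pr : ℕ → Prop) (ok : ℕ → ℕ × ℕ → Prop) {D : Finset (ℕ × ℕ)}
    (f : D → ℕ) : Prop where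
  row : ∀ c d : D, c.1.1 = d.1.1 → c.1.2 < d.1.2 → f c ≤ f d ∧ (pr (f c) → f c ≠ f d)
  col : ∀ c d : D, c.1.2 = d.1.2 → c.1.1 < d.1.1 → f c ≤ f d ∧ (¬ pr (f c) → f c ≠ f d)
  ok : ∀ c : D, ok (f c) c.1

open Classical in
/-- The admissible numberings of `D` by `0, …, N - 1`. -/
noncomputable def admissible (pr : ℕ → Prop) (ok : ℕ → ℕ × ℕ → Prop) (N : ℕ)
    (D : Finset (ℕ × ℕ)) : Finset (D → ℕ) :=
  (Fintype.piFinset fun _ : D => Finset.range N).filter (IsAdmissible pr ok)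

theorem mem_admissible {pr : ℕ → Prop} {ok : ℕ → ℕ × ℕ → Prop} {N : ℕ} {D : Finset (ℕ × ℕ)}
    {f : D → ℕ} : f ∈ admissible pr ok N D ↔ (∀ c, f c < N) ∧ IsAdmissible pr ok f := by
  simp [admissible, Fintype.mem_piFinset]

/-- The generating function of the admissible numberings of `D` by `0, …, N - 1`. -/
noncomputable def genFun (pr : ℕ → Prop) (ok : ℕ → ℕ × ℕ → Prop) (w : ℕ → R) (N : ℕ)
    (D : Finset (ℕ × ℕ)) : R :=
  ∑ f ∈ admissible pr ok N D, ∏ c, w (f c)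

/-- The complement of `E` in `D` can be the set of cells with the largest entry, if that entry
has `pr` or not according to `p`, and is allowed in the cells `ok`. -/
structure IsStrip (p : Prop) (ok : ℕ × ℕ → Prop) (D E : Finset (ℕ × ℕ)) : Prop where
  row : ∀ c ∈ D, c ∉ E → ∀ d ∈ D, c.1 = d.1 → c.2 < d.2 → d ∉ E ∧ ¬ p
  col : ∀ c ∈ D, c ∉ E → ∀ d ∈ D, c.2 = d.2 → c.1 < d.1 → d ∉ E ∧ p
  ok : ∀ c ∈ D, c ∉ E → ok c

-- The numberings are grouped by the set E of cells with entry below N; the other cells all carry N,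
-- and the conditions involving them say precisely that E leaves a strip.
open Classical in
theorem genFun_succ (pr : ℕ → Prop) (ok : ℕ → ℕ × ℕ → Prop) (w : ℕ → R) (N : ℕ)
    (D : Finset (ℕ × ℕ)) :
    genFun pr ok w (N + 1) D =
      ∑ E ∈ D.powerset.filter (IsStrip (pr N) (ok N) D),
        w N ^ (D \ E).card * genFun pr ok w N E := by
  set sub : (D → ℕ) → Finset (ℕ × ℕ) := fun f =>
    (Finset.univ.filter fun c : D => f c < N).map (Function.Embedding.subtype _) with hsub
  have mem_sub : ∀ (f : D → ℕ) (c : D), c.1 ∈ sub f ↔ f c < N := by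
    intro f c
    simp [hsub]
  have sub_subset : ∀ f, sub f ⊆ D := by
    intro f c hc
    simp only [hsub, Finset.mem_map] at hc
    obtain ⟨d, -, rfl⟩ := hc
    exact d.2
  have eq_N : ∀ f ∈ admissible pr ok (N + 1) D, ∀ c : D, c.1 ∉ sub f → f c = N := by
    intro f hf c hc
    have h1 := (mem_admissible.1 hf).1 c
    rw [mem_sub] at hc
    omega
  rw [genFun, ← Finset.sum_fiberwise_of_maps_to
    (t := D.powerset.filter (IsStrip (pr N) (ok N) D)) (g := sub)]
  · refine Finset.sum_congr rfl fun E hE => ?_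
    rw [Finset.mem_filter, Finset.mem_powerset] at hE
    obtain ⟨hED, hE⟩ := hE
    rw [genFun, Finset.mul_sum]
    refine Finset.sum_bij' (fun f _ => fun c : E => f ⟨c.1, hED c.2⟩)
      (fun g _ => fun c : D => if h : c.1 ∈ E then g ⟨c.1, h⟩ else N) ?_ ?_ ?_ ?_ ?_
    · intro f hf
      rw [Finset.mem_filter] at hf
      obtain ⟨hf, rfl⟩ := hf
      obtain ⟨-, h⟩ := mem_admissible.1 hf
      exact mem_admissible.2 ⟨fun c => (mem_sub f ⟨c.1, hED c.2⟩).1 c.2,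
        ⟨fun c d => h.row ⟨c.1, hED c.2⟩ ⟨d.1, hED d.2⟩, fun c d => h.col ⟨c.1, hED c.2⟩ ⟨d.1, hED d.2⟩,
          fun c => h.ok ⟨c.1, hED c.2⟩⟩⟩
    · intro g hg
      obtain ⟨hlt, h⟩ := mem_admissible.1 hg
      rw [Finset.mem_filter, mem_admissible]
      refine ⟨⟨fun c => ?_, ⟨fun c d h1 h2 => ?_, fun c d h1 h2 => ?_, fun c => ?_⟩⟩, ?_⟩
      · by_cases hc : c.1 ∈ E
        · simpa [hc] using (hlt ⟨c.1, hc⟩).le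
        · simp [hc]
      · by_cases hc : c.1 ∈ E <;> by_cases hd : d.1 ∈ E
        · simpa [hc, hd] using h.row ⟨c.1, hc⟩ ⟨d.1, hd⟩ h1 h2
        · have := hlt ⟨c.1, hc⟩
          simp [hc, hd, this.le, this.ne]
        · exact absurd hd (hE.row c.1 c.2 hc d.1 d.2 h1 h2).1
        · simpa [hc, hd] using (hE.row c.1 c.2 hc d.1 d.2 h1 h2).2
      · by_cases hc : c.1 ∈ E <;> by_cases hd : d.1 ∈ E
        · simpa [hc, hd] using h.col ⟨c.1, hc⟩ ⟨d.1, hd⟩ h1 h2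
        · have := hlt ⟨c.1, hc⟩
          simp [hc, hd, this.le, this.ne]
        · exact absurd hd (hE.col c.1 c.2 hc d.1 d.2 h1 h2).1
        · simpa [hc, hd] using (hE.col c.1 c.2 hc d.1 d.2 h1 h2).2
      · by_cases hc : c.1 ∈ E
        · simpa [hc] using h.ok ⟨c.1, hc⟩
        · simpa [hc] using hE.ok c.1 c.2 hc
      · ext c
        constructor
        · intro hc
          have hcD := sub_subset _ hc
          have := (mem_sub _ ⟨c, hcD⟩).1 hc
          by_contra hcE
          simp [hcE] at this
        · intro hc
          refine (mem_sub _ ⟨c, hED hc⟩).2 ?_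
          simpa [hc] using hlt ⟨c, hc⟩
    · intro f hf
      rw [Finset.mem_filter] at hf
      obtain ⟨hf, rfl⟩ := hf
      ext c
      by_cases hc : c.1 ∈ sub f
      · simp [hc]
      · simp [hc, eq_N f hf c hc]
    · intro g hg
      ext c
      simp
    · intro f hf
      rw [Finset.mem_filter] at hf
      obtain ⟨hf, rfl⟩ := hf
      rw [← Finset.prod_filter_not_mul_prod_filter _ (fun c : D => c.1 ∈ sub f)]
      congr 1
      · rw [Finset.prod_congr rfl (g := fun _ => w N), Finset.prod_const]
        · congr 1
          refine Finset.card_bij (fun c _ => c.1) ?_ ?_ ?_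
          · intro c hc
            simpa using hc
          · intro c _ d _ h
            exact Subtype.ext h
          · intro c hc
            rw [Finset.mem_sdiff] at hc
            exact ⟨⟨c, hc.1⟩, by simpa using hc.2, rfl⟩
        · intro c hc
          rw [Finset.mem_filter] at hc
          rw [eq_N f hf c hc.2]
      · refine Finset.prod_bij' (fun c hc => ⟨c.1, (Finset.mem_filter.1 hc).2⟩)
          (fun c _ => ⟨c.1, hED c.2⟩) ?_ ?_ ?_ ?_ ?_ <;> simp
  · intro f hf
    have h := (mem_admissible.1 hf).2
    rw [Finset.mem_filter, Finset.mem_powerset]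
    have key : ∀ c (hcD : c ∈ D), c ∉ sub f → ∀ d (hdD : d ∈ D), f ⟨c, hcD⟩ ≤ f ⟨d, hdD⟩ →
        d ∉ sub f := by
      intro c hcD hc d hdD hle hd
      have h1 := eq_N f hf ⟨c, hcD⟩ hc
      have h2 := (mem_sub f ⟨d, hdD⟩).1 hd
      omega
    refine ⟨sub_subset f, ⟨fun c hcD hc d hdD h1 h2 => ?_, fun c hcD hc d hdD h1 h2 => ?_,
      fun c hcD hc => ?_⟩⟩
    · have hr := h.row ⟨c, hcD⟩ ⟨d, hdD⟩ h1 h2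
      have hd := key c hcD hc d hdD hr.1
      refine ⟨hd, ?_⟩
      simpa [eq_N f hf ⟨c, hcD⟩ hc, eq_N f hf ⟨d, hdD⟩ hd] using hr.2
    · have hr := h.col ⟨c, hcD⟩ ⟨d, hdD⟩ h1 h2
      have hd := key c hcD hc d hdD hr.1
      refine ⟨hd, ?_⟩
      simpa [eq_N f hf ⟨c, hcD⟩ hc, eq_N f hf ⟨d, hdD⟩ hd] using hr.2
    · simpa [eq_N f hf ⟨c, hcD⟩ hc] using h.ok ⟨c, hcD⟩

/-! ### Diagrams of strictly decreasing sequences and their strips -/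

/-- The cells `(i, c)` with `i ≤ c + b < a i + i`: for `b = 0` this is the shifted diagram of
`a`. -/
def cells {k : ℕ} (b : ℕ) (a : Fin k → ℕ) : Finset (ℕ × ℕ) :=
  Finset.univ.biUnion fun i : Fin k =>
    (Finset.Ico ((i : ℕ) - b) (a i + i - b)).image fun j => ((i : ℕ), j)

theorem mem_cells {k b : ℕ} {a : Fin k → ℕ} {x : ℕ × ℕ} :
    x ∈ cells b a ↔ ∃ i : Fin k, (i : ℕ) = x.1 ∧ i ≤ x.2 + b ∧ x.2 + b < a i + i := by
  simp only [cells, Finset.mem_biUnion, Finset.mem_univ, true_and, Finset.mem_image,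
    Finset.mem_Ico]
  constructor
  · rintro ⟨i, j, ⟨h1, h2⟩, rfl⟩
    exact ⟨i, rfl, by simp only; omega, by simp only; omega⟩
  · rintro ⟨i, h1, h2, h3⟩
    exact ⟨i, x.2, ⟨by omega, by omega⟩, by rw [h1]⟩

theorem mk_mem_cells {k b : ℕ} {a : Fin k → ℕ} {i : Fin k} {c : ℕ} :
    ((i : ℕ), c) ∈ cells b a ↔ (i : ℕ) ≤ c + b ∧ c + b < a i + i := by
  rw [mem_cells]
  constructor
  · rintro ⟨j, h1, h2⟩
    obtain rfl := Fin.ext h1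
    exact h2
  · intro h
    exact ⟨i, rfl, h⟩

theorem add_le_add_of_strictAnti {k : ℕ} {a : Fin k → ℕ} (ha : StrictAnti a) {i j : Fin k}
    (hij : i ≤ j) : a j + j ≤ a i + i := by
  obtain ⟨j, hj⟩ := j
  induction j with
  | zero =>
    have : i = ⟨0, hj⟩ := le_antisymm hij (Fin.mk_le_mk.2 (Nat.zero_le _))
    rw [this]
  | succ j ih =>
    rcases hij.eq_or_lt with rfl | h
    · rfl
    · have h1 : i ≤ ⟨j, by omega⟩ := by
        rw [Fin.le_def]
        rw [Fin.lt_def] at h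
        simp only at h ⊢
        omega
      have h2 := ih (by omega) h1
      have h3 : a ⟨j + 1, hj⟩ < a ⟨j, by omega⟩ := ha (Fin.mk_lt_mk.2 (Nat.lt_succ_self j))
      simp only at h2 ⊢
      omega

/-- This keeps the right end a i + i - b of a row from being truncated, so that the diagram
determines the sequence. -/
theorem le_add_of_strictAnti {m b : ℕ} (hb : b ≤ m) {a : Fin (m + 1) → ℕ} (ha : StrictAnti a)
    (i : Fin (m + 1)) : b ≤ a i + i := by
  have := add_le_add_of_strictAnti ha (Fin.le_last i)
  simp only [Fin.val_last] at this
  omega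

theorem card_cells_sdiff {k b : ℕ} {a ν : Fin k → ℕ} (hν : ∀ i, b ≤ ν i + i) :
    (cells b a \ cells b ν).card = ∑ i, (a i - ν i) := by
  have : ∑ i, (a i - ν i) = (Finset.univ.sigma fun i : Fin k => Finset.Ico (ν i) (a i)).card := by
    simp [Finset.card_sigma]
  rw [this]
  symm
  refine Finset.card_bij (fun x _ => ((x.1 : ℕ), x.2 + x.1 - b)) ?_ ?_ ?_
  · rintro ⟨i, r⟩ h
    simp only [Finset.mem_sigma, Finset.mem_univ, true_and, Finset.mem_Ico] at h
    have := hν i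
    rw [Finset.mem_sdiff, mk_mem_cells, mk_mem_cells]
    dsimp only
    omega
  · rintro ⟨i, r⟩ h ⟨j, s⟩ h' heq
    simp only [Finset.mem_sigma, Finset.mem_univ, true_and, Finset.mem_Ico] at h h'
    simp only [Prod.mk.injEq] at heq
    obtain rfl := Fin.ext heq.1
    have := hν i
    have : r = s := by omega
    rw [this]
  · rintro ⟨i, c⟩ h
    rw [Finset.mem_sdiff, mem_cells] at h
    obtain ⟨⟨i, rfl, h1, h2⟩, h3⟩ := h
    simp only at h1 h2 h3
    rw [mk_mem_cells] at h3
    refine ⟨⟨i, c + b - i⟩, ?_, ?_⟩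
    · simp only [Finset.mem_sigma, Finset.mem_univ, true_and, Finset.mem_Ico]
      omega
    · simp only [Prod.mk.injEq, true_and]
      omega

theorem cells_injOn {k b : ℕ} {ν ν' : Fin k → ℕ} (hν : ∀ i, b ≤ ν i + i)
    (hν' : ∀ i, b ≤ ν' i + i) (h : cells b ν = cells b ν') : ν = ν' := by
  have key : ∀ {ν ν' : Fin k → ℕ}, (∀ i, b ≤ ν i + i) → cells b ν = cells b ν' → ∀ i, ν' i ≤ ν i := by
    intro ν ν' hν h i
    by_contra! hlt
    have h1 : ((i : ℕ), ν i + i - b) ∈ cells b ν' := by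
      have := hν i
      rw [mk_mem_cells]
      omega
    rw [← h, mk_mem_cells] at h1
    have := hν i
    omega
  ext i
  exact le_antisymm (key hν' h.symm i) (key hν h i)

theorem exists_eq_cells {k b : ℕ} {a : Fin k → ℕ} (ha : ∀ i, b ≤ a i + i) {E : Finset (ℕ × ℕ)}
    (hE : E ⊆ cells b a)
    (hrow : ∀ c ∈ cells b a, c ∉ E → ∀ d ∈ cells b a, c.1 = d.1 → c.2 < d.2 → d ∉ E) :
    ∃ ν : Fin k → ℕ, (∀ i, b ≤ ν i + i) ∧ (∀ i, ν i ≤ a i) ∧ cells b ν = E := by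
  classical
  have hex : ∀ i : Fin k, ∃ r, b ≤ r + i ∧ ((i : ℕ), r + i - b) ∉ E := fun i => by
    refine ⟨a i, ha i, fun h => ?_⟩
    have := mk_mem_cells.1 (hE h)
    have := ha i
    omega
  -- The new length of row i is given by its first cell missing from E; by `hrow` all later cells
  -- are missing too.
  refine ⟨fun i => Nat.find (hex i), fun i => (Nat.find_spec (hex i)).1, fun i => ?_, ?_⟩
  · refine Nat.find_min' _ ⟨ha i, fun h => ?_⟩
    have := mk_mem_cells.1 (hE h)
    have := ha i
    omega
  · ext ⟨i, c⟩
    constructor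
    · intro h
      obtain ⟨i, rfl, h1, h2⟩ := mem_cells.1 h
      simp only at h1 h2
      by_contra hc
      have := Nat.find_min' (hex i) (m := c + b - i) ⟨by omega, by
        rwa [show c + b - i + i - b = c by omega]⟩
      omega
    · intro h
      obtain ⟨i, rfl, h1, h2⟩ := mem_cells.1 (hE h)
      simp only at h1 h2
      rw [mk_mem_cells]
      refine ⟨h1, ?_⟩
      obtain ⟨h3, h4⟩ := Nat.find_spec (hex i)
      by_contra! hle
      rcases (show Nat.find (hex i) + i - b ≤ c by omega).eq_or_lt with heq | hlt
      · rw [heq] at h4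
        exact h4 h
      · exact hrow _ (mk_mem_cells.2 (by omega)) h4 _ (hE h) rfl hlt h

open Classical in
theorem sum_isStrip {m b : ℕ} (hb : b ≤ m) {a : Fin (m + 1) → ℕ} (ha : StrictAnti a)
    {p : Prop} {ok : ℕ × ℕ → Prop} {s : Finset (Fin (m + 1) → ℕ)}
    (hs : ∀ ν ∈ s, StrictAnti ν ∧ ∀ i, ν i ≤ a i)
    (hstrip : ∀ ν ∈ s, IsStrip p ok (cells b a) (cells b ν))
    (hmem : ∀ ν : Fin (m + 1) → ℕ, (∀ i, b ≤ ν i + i) → (∀ i, ν i ≤ a i) →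
      IsStrip p ok (cells b a) (cells b ν) → ν ∈ s)
    (q : R) (F : Finset (ℕ × ℕ) → R) :
    ∑ E ∈ (cells b a).powerset.filter (IsStrip p ok (cells b a)),
        q ^ (cells b a \ E).card * F E =
      ∑ ν ∈ s, (∏ j, q ^ (a j - ν j)) * F (cells b ν) := by
  symm
  refine Finset.sum_bij (fun ν _ => cells b ν) ?_ ?_ ?_ ?_
  · intro ν hν
    rw [Finset.mem_filter, Finset.mem_powerset]
    refine ⟨fun x hx => ?_, hstrip ν hν⟩
    obtain ⟨i, h1, h2, h3⟩ := mem_cells.1 hx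
    have := (hs ν hν).2 i
    exact mem_cells.2 ⟨i, h1, h2, by omega⟩
  · intro ν hν ν' hν' h
    exact cells_injOn (le_add_of_strictAnti hb (hs ν hν).1)
      (le_add_of_strictAnti hb (hs ν' hν').1) h
  · intro E hE
    rw [Finset.mem_filter, Finset.mem_powerset] at hE
    obtain ⟨ν, h1, h2, rfl⟩ := exists_eq_cells (le_add_of_strictAnti hb ha) hE.1
      fun c hc hcE d hd h h' => (hE.2.row c hc hcE d hd h h').1
    exact ⟨ν, hmem ν h1 h2 hE.2, rfl⟩
  · intro ν hν
    rw [card_cells_sdiff (le_add_of_strictAnti hb (hs ν hν).1), Finset.prod_pow_eq_pow_sum]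

theorem mem_horizontalStrips {m : ℕ} {a ν : Fin (m + 1) → ℕ} :
    ν ∈ horizontalStrips a ↔ (∀ j, ν j ≤ a j) ∧ ∀ j : Fin m, a j.succ < ν j.castSucc := by
  simp only [horizontalStrips, Fintype.mem_piFinset, Finset.mem_Ico, Nat.lt_succ_iff]
  constructor
  · intro h
    exact ⟨fun j => (h j).2, fun j => by simpa [lowerBound] using (h j.castSucc).1⟩
  · rintro ⟨h1, h2⟩ j
    refine ⟨?_, h1 j⟩
    refine Fin.lastCases ?_ (fun j => ?_) j
    · simp [lowerBound]
    · simpa [lowerBound] using h2 j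

theorem mem_verticalStrips {m : ℕ} {a ν : Fin (m + 1) → ℕ} :
    ν ∈ verticalStrips a ↔ (∀ j, ν j ≤ a j) ∧ (∀ j, a j ≤ ν j + 1) ∧ StrictAnti ν := by
  simp only [verticalStrips, Finset.mem_filter, Fintype.mem_piFinset, Finset.mem_Icc]
  constructor
  · rintro ⟨h, hs⟩
    exact ⟨fun j => (h j).2, fun j => by have := (h j).1; omega, hs⟩
  · rintro ⟨h1, h2, hs⟩
    exact ⟨fun j => ⟨by have := h2 j; omega, h1 j⟩, hs⟩

theorem strictAnti_of_mem_horizontalStrips {m : ℕ} {a ν : Fin (m + 1) → ℕ}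
    (hν : ν ∈ horizontalStrips a) : StrictAnti ν := by
  rw [mem_horizontalStrips] at hν
  exact Fin.strictAnti_iff_succ_lt.2 fun j => (hν.1 _).trans_lt (hν.2 j)

/-- Row `i < m` admits the largest entry in all columns but the first one of the shifted row, and
row `m` in all columns. -/
def IsTopAllowed {m : ℕ} (b : ℕ) (a : Fin (m + 1) → ℕ) (ok : ℕ × ℕ → Prop) : Prop :=
  ∀ c ∈ cells b a, ok c ↔ c.1 = m ∨ c.1 + 1 ≤ c.2 + b

theorem exists_rows {m b : ℕ} {a ν : Fin (m + 1) → ℕ} {c : ℕ × ℕ} (hc : c ∈ cells b a)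
    (hcν : c ∉ cells b ν) :
    ∃ i : Fin (m + 1), (i : ℕ) = c.1 ∧ i ≤ c.2 + b ∧ c.2 + b < a i + i ∧ ν i + i ≤ c.2 + b := by
  obtain ⟨i, h1, h2, h3⟩ := mem_cells.1 hc
  refine ⟨i, h1, h2, h3, ?_⟩
  by_contra! h
  exact hcν (mem_cells.2 ⟨i, h1, h2, h⟩)

theorem isStrip_row {m b : ℕ} {a ν : Fin (m + 1) → ℕ} :
    ∀ c ∈ cells b a, c ∉ cells b ν → ∀ d ∈ cells b a, c.1 = d.1 → c.2 < d.2 →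
      d ∉ cells b ν := by
  intro c hc hcν d _ h1 h2 hdν
  obtain ⟨i, hi, h3, h4, h5⟩ := exists_rows hc hcν
  obtain ⟨j, hj, h6, h7⟩ := mem_cells.1 hdν
  obtain rfl : i = j := Fin.ext (by omega)
  omega

theorem isStrip_col {m b : ℕ} {a ν : Fin (m + 1) → ℕ} (hν : StrictAnti ν) :
    ∀ c ∈ cells b a, c ∉ cells b ν → ∀ d ∈ cells b a, c.2 = d.2 → c.1 < d.1 →
      d ∉ cells b ν := by
  intro c hc hcν d _ h1 h2 hdν
  obtain ⟨i, hi, h3, h4, h5⟩ := exists_rows hc hcν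
  obtain ⟨j, hj, h6, h7⟩ := mem_cells.1 hdν
  have := add_le_add_of_strictAnti hν (i := i) (j := j) (Fin.le_def.2 (by omega))
  omega

theorem isStrip_ok {m b : ℕ} {a ν : Fin (m + 1) → ℕ} (hν : StrictAnti ν)
    {ok : ℕ × ℕ → Prop} (hok : IsTopAllowed b a ok) :
    ∀ c ∈ cells b a, c ∉ cells b ν → ok c := by
  intro c hc hcν
  rw [hok c hc]
  obtain ⟨i, hi, h3, h4, h5⟩ := exists_rows hc hcν
  by_cases him : i = Fin.last m
  · left
    rw [← hi, him, Fin.val_last]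
  · right
    have := hν (Fin.lt_last_iff_ne_last.2 him)
    omega

/-- The first cell removed from row j is not the first cell of its shifted row, by `hok`, so under
the assumption on ν j the cell below it lies in the diagram of a. The column condition then forces p
and the removal of that lower cell as well. -/
theorem isStrip_cells_lt {m b : ℕ} {a ν : Fin (m + 1) → ℕ} (ha : StrictAnti a)
    (hb : ∀ i, b ≤ ν i + i) {ok : ℕ × ℕ → Prop} (hok : IsTopAllowed b a ok) {p : Prop}
    (h : IsStrip p ok (cells b a) (cells b ν)) (j : Fin m)
    (hj : ν j.castSucc ≤ a j.succ) : p ∧ ν j.succ < ν j.castSucc := by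
  have h1 := hb j.castSucc
  have h2 : a j.succ < a j.castSucc := ha Fin.castSucc_lt_succ
  simp only [Fin.val_castSucc] at h1
  have hc : (((j.castSucc : Fin (m + 1)) : ℕ), ν j.castSucc + j - b) ∈ cells b a := by
    rw [mk_mem_cells]
    simp only [Fin.val_castSucc]
    omega
  have hcν : (((j.castSucc : Fin (m + 1)) : ℕ), ν j.castSucc + j - b) ∉ cells b ν := by
    rw [mk_mem_cells]
    simp only [Fin.val_castSucc]
    omega
  have h3 := (hok _ hc).1 (h.ok _ hc hcν)
  simp only [Fin.val_castSucc] at h3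
  have hjm := j.2
  have hd : (((j.succ : Fin (m + 1)) : ℕ), ν j.castSucc + j - b) ∈ cells b a := by
    rw [mk_mem_cells]
    simp only [Fin.val_succ]
    omega
  have h4 := h.col _ hc hcν _ hd rfl (by simp)
  refine ⟨h4.2, ?_⟩
  by_contra! hle
  refine h4.1 ?_
  rw [mk_mem_cells]
  simp only [Fin.val_succ]
  omega

theorem genFun_succ_of_not {m b N : ℕ} (hb : b ≤ m) {a : Fin (m + 1) → ℕ} (ha : StrictAnti a)
    {pr : ℕ → Prop} {ok : ℕ → ℕ × ℕ → Prop} (hpr : ¬ pr N) (hok : IsTopAllowed b a (ok N))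
    (w : ℕ → R) :
    genFun pr ok w (N + 1) (cells b a) =
      ∑ ν ∈ horizontalStrips a, (∏ j, w N ^ (a j - ν j)) * genFun pr ok w N (cells b ν) := by
  rw [genFun_succ]
  refine sum_isStrip hb ha (fun ν hν => ⟨strictAnti_of_mem_horizontalStrips hν,
    (mem_horizontalStrips.1 hν).1⟩) ?_ ?_ _ _
  · intro ν hν
    have hs := strictAnti_of_mem_horizontalStrips hν
    rw [mem_horizontalStrips] at hν
    refine ⟨fun c hc hcν d hd h1 h2 => ⟨isStrip_row c hc hcν d hd h1 h2, hpr⟩,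
      fun c hc hcν d hd h1 h2 => ?_, isStrip_ok hs hok⟩
    exfalso
    obtain ⟨i, hi, h3, h4, h5⟩ := exists_rows hc hcν
    obtain ⟨j, hj, h6, h7⟩ := mem_cells.1 hd
    have hj' := j.2
    -- A cell lies below row i, so i is not the last row and interlacing with the next part is
    -- available.
    obtain ⟨i', rfl⟩ : ∃ i' : Fin m, i = i'.castSucc := ⟨⟨i, by omega⟩, rfl⟩
    have h8 := add_le_add_of_strictAnti ha (i := i'.succ) (j := j)
      (Fin.le_def.2 (by simp only [Fin.val_succ, Fin.val_castSucc] at hi ⊢; omega))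
    have h9 := hν.2 i'
    simp only [Fin.val_castSucc, Fin.val_succ] at *
    omega
  · intro ν hν hle h
    rw [mem_horizontalStrips]
    refine ⟨hle, fun j => ?_⟩
    by_contra! hj
    exact hpr (isStrip_cells_lt ha hν hok h j hj).1

theorem genFun_succ_of {m b N : ℕ} (hb : b ≤ m) {a : Fin (m + 1) → ℕ} (ha : StrictAnti a)
    {pr : ℕ → Prop} {ok : ℕ → ℕ × ℕ → Prop} (hpr : pr N) (hok : IsTopAllowed b a (ok N))
    (w : ℕ → R) :
    genFun pr ok w (N + 1) (cells b a) =
      ∑ ν ∈ verticalStrips a, (∏ j, w N ^ (a j - ν j)) * genFun pr ok w N (cells b ν) := by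
  rw [genFun_succ]
  refine sum_isStrip hb ha (fun ν hν => ⟨(mem_verticalStrips.1 hν).2.2,
    (mem_verticalStrips.1 hν).1⟩) ?_ ?_ _ _
  · intro ν hν
    rw [mem_verticalStrips] at hν
    refine ⟨fun c hc hcν d hd h1 h2 => ?_,
      fun c hc hcν d hd h1 h2 => ⟨isStrip_col hν.2.2 c hc hcν d hd h1 h2, hpr⟩,
      isStrip_ok hν.2.2 hok⟩
    exfalso
    obtain ⟨i, hi, h3, h4, h5⟩ := exists_rows hc hcν
    obtain ⟨j, hj, h6, h7⟩ := mem_cells.1 hd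
    obtain rfl : i = j := Fin.ext (by omega)
    have := hν.2.1 i
    omega
  · intro ν hν hle h
    rw [mem_verticalStrips]
    refine ⟨hle, fun j => ?_, Fin.strictAnti_iff_succ_lt.2 fun j => ?_⟩
    -- Otherwise row j would lose two adjacent cells, and a primed letter would be repeated in it.
    · by_contra! hj
      have h1 := hν j
      refine (h.row (j, ν j + j - b) (mk_mem_cells.2 (by omega)) (fun hc => ?_)
        (j, ν j + j - b + 1) (mk_mem_cells.2 (by omega)) rfl (Nat.lt_succ_self _)).2 hpr
      rw [mk_mem_cells] at hc
      omega
    · by_contra! hj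
      exact absurd (isStrip_cells_lt ha hν hok h j (hj.trans (hle _))).2 (not_lt.2 hj)

theorem genFun_succ_eq_coeffDet_of_not {m b N : ℕ} (hb : b ≤ m) {pr : ℕ → Prop}
    {ok : ℕ → ℕ × ℕ → Prop} (hpr : ¬ pr N) {w : ℕ → R} {Φ : Fin (m + 1) → PowerSeries R}
    (hok : ∀ a : Fin (m + 1) → ℕ, IsTopAllowed b a (ok N))
    (h : ∀ a : Fin (m + 1) → ℕ, StrictAnti a → genFun pr ok w N (cells b a) = coeffDet Φ a)
    (a : Fin (m + 1) → ℕ) (ha : StrictAnti a) :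
    genFun pr ok w (N + 1) (cells b a) = coeffDet (fun i => Φ i * geom (w N)) a := by
  rw [genFun_succ_of_not hb ha hpr (hok a), ← sum_horizontalStrips _ _ ha]
  exact Finset.sum_congr rfl fun ν hν => by rw [h ν (strictAnti_of_mem_horizontalStrips hν)]

theorem genFun_succ_eq_coeffDet_of {m b N : ℕ} (hb : b ≤ m) {pr : ℕ → Prop}
    {ok : ℕ → ℕ × ℕ → Prop} (hpr : pr N) {w : ℕ → R} {Φ : Fin (m + 1) → PowerSeries R}
    (hok : ∀ a : Fin (m + 1) → ℕ, IsTopAllowed b a (ok N))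
    (h : ∀ a : Fin (m + 1) → ℕ, StrictAnti a → genFun pr ok w N (cells b a) = coeffDet Φ a)
    (a : Fin (m + 1) → ℕ) (ha : StrictAnti a) :
    genFun pr ok w (N + 1) (cells b a) =
      coeffDet (fun i => Φ i * (1 + PowerSeries.C (w N) * PowerSeries.X)) a := by
  rw [genFun_succ_of hb ha hpr (hok a), ← sum_verticalStrips _ _ ha]
  exact Finset.sum_congr rfl fun ν hν => by rw [h ν (mem_verticalStrips.1 hν).2.2]

theorem genFun_eq_zero {pr : ℕ → Prop} {ok : ℕ → ℕ × ℕ → Prop} {w : ℕ → R} {N : ℕ}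
    {D : Finset (ℕ × ℕ)} {c : ℕ × ℕ} (hc : c ∈ D) (h : ∀ r < N, ¬ ok r c) :
    genFun pr ok w N D = 0 := by
  rw [genFun, Finset.sum_eq_zero]
  intro f hf
  obtain ⟨h1, h2⟩ := mem_admissible.1 hf
  exact absurd (h2.ok ⟨c, hc⟩) (h _ (h1 ⟨c, hc⟩))

theorem genFun_cells_zero {pr : ℕ → Prop} {ok : ℕ → ℕ × ℕ → Prop} {w : ℕ → R} {N b : ℕ}
    (a : Fin 0 → ℕ) : genFun pr ok w N (cells b a) = 1 := by
  have : cells b a = ∅ := by simp [cells]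
  rw [this, genFun, Finset.sum_eq_card_nsmul (b := 1)]
  · have : (admissible pr ok N ∅).card = 1 := by
      rw [Finset.card_eq_one]
      refine ⟨fun _ => 0, ?_⟩
      ext f
      have : f = fun _ => 0 := Subsingleton.elim _ _
      rw [this, Finset.mem_singleton, mem_admissible]
      simp only [iff_true]
      exact ⟨fun c => absurd c.2 (Finset.notMem_empty _),
        ⟨fun c => absurd c.2 (Finset.notMem_empty _),
          fun c => absurd c.2 (Finset.notMem_empty _), fun c => absurd c.2 (Finset.notMem_empty _)⟩⟩
    rw [this, one_smul]
  · intro f _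
    simp

theorem StrictAnti.castSucc_pos {m : ℕ} {a : Fin (m + 1) → ℕ} (ha : StrictAnti a) (i : Fin m) :
    0 < a i.castSucc :=
  lt_of_le_of_lt (Nat.zero_le _) (ha (Fin.castSucc_lt_last i))

/-! ### Determinantal formulas for the two kinds of tableaux -/

/-- The weights of the letters of primed shifted tableaux, by rank. -/
def primedWeight (x xb y yb : ℕ → R) (r : ℕ) : R :=
  if r % 4 = 0 then yb (r / 4) else if r % 4 = 1 then xb (r / 4) else
    if r % 4 = 2 then y (r / 4) else x (r / 4)

/-- The contribution of the letters `k̄', k̄, k', k` to the generating function. -/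
noncomputable def primedFactor (x xb y yb : ℕ → R) (k : ℕ) : PowerSeries R :=
  (1 + PowerSeries.C (yb k) * PowerSeries.X) * geom (xb k) *
    (1 + PowerSeries.C (y k) * PowerSeries.X) * geom (x k)

/-- The rows of the determinant of the generating function of primed shifted tableaux. -/
noncomputable def primedSeries (x xb y yb : ℕ → R) : (k : ℕ) → Fin k → PowerSeries R
  | 0 => Fin.elim0
  | k + 1 => fun i =>
    Fin.snoc (α := fun _ => PowerSeries R) (primedSeries x xb y yb k) 1 i *
      primedFactor x xb y yb k

theorem isTopAllowed_primed {m s : ℕ} (hs : s < 4) (a : Fin (m + 1) → ℕ) :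
    IsTopAllowed 0 a fun c => c.1 = c.2 → (4 * m + s) / 4 = c.1 := by
  intro c hc
  obtain ⟨i, h1, h2, h3⟩ := mem_cells.1 hc
  have h4 : (4 * m + s) / 4 = m := by omega
  rw [h4]
  constructor
  · intro h
    by_cases hc : c.1 = c.2
    · exact Or.inl (h hc).symm
    · right; omega
  · rintro (h | h) h5 <;> omega

/-- Induction on the number of rows. Letters of index below k cannot fill the diagonal cell (k, k),
so before the four letters of index k are added row k is empty; this is the appended series 1. Each
of the four letters then contributes one factor of `primedFactor`. -/
theorem genFun_primed (x xb y yb : ℕ → R) (k : ℕ) (a : Fin k → ℕ) (ha : StrictAnti a) :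
    genFun (fun r => r % 2 = 0) (fun r c => c.1 = c.2 → r / 4 = c.1)
      (primedWeight x xb y yb) (4 * k) (cells 0 a) = coeffDet (primedSeries x xb y yb k) a := by
  induction k with
  | zero => rw [genFun_cells_zero, coeffDet, Matrix.det_isEmpty]
  | succ k ih =>
    have h0 : ∀ a : Fin (k + 1) → ℕ, StrictAnti a →
        genFun (fun r => r % 2 = 0) (fun r c => c.1 = c.2 → r / 4 = c.1)
          (primedWeight x xb y yb) (4 * k) (cells 0 a) =
        coeffDet (Fin.snoc (α := fun _ => PowerSeries R) (primedSeries x xb y yb k) 1) a := by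
      intro a ha
      rw [coeffDet_snoc_one _ ha]
      split_ifs with h
      · rw [← ih (fun i => a i.castSucc) (ha.comp_strictMono Fin.strictMono_castSucc)]
        congr 1
        ext c
        simp [mem_cells, Fin.exists_fin_succ', h]
      · refine genFun_eq_zero (c := (k, k)) (mem_cells.2 ⟨Fin.last k, rfl, ?_⟩) ?_
        · simp only [Fin.val_last]
          omega
        · intro r hr hcon
          have := hcon rfl
          simp only at this
          omega
    have h1 := genFun_succ_eq_coeffDet_of (Nat.zero_le k) (by omega)
      (isTopAllowed_primed (s := 0) (by omega)) h0
    have h2 := genFun_succ_eq_coeffDet_of_not (Nat.zero_le k) (by omega)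
      (isTopAllowed_primed (s := 1) (by omega)) h1
    have h3 := genFun_succ_eq_coeffDet_of (Nat.zero_le k) (by omega)
      (isTopAllowed_primed (s := 2) (by omega)) h2
    have h4 := genFun_succ_eq_coeffDet_of_not (Nat.zero_le k) (by omega)
      (isTopAllowed_primed (s := 3) (by omega)) h3
    rw [show 4 * (k + 1) = 4 * k + 1 + 1 + 1 + 1 by ring, h4 a ha]
    congr 1
    ext1 i
    have e0 : primedWeight x xb y yb (4 * k) = yb k := by
      rw [primedWeight, if_pos (by omega)]
      congr 1; omega
    have e1 : primedWeight x xb y yb (4 * k + 1) = xb k := by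
      rw [primedWeight, if_neg (by omega), if_pos (by omega)]
      congr 1; omega
    have e2 : primedWeight x xb y yb (4 * k + 1 + 1) = y k := by
      rw [primedWeight, if_neg (by omega), if_neg (by omega), if_pos (by omega)]
      congr 1; omega
    have e3 : primedWeight x xb y yb (4 * k + 1 + 1 + 1) = x k := by
      rw [primedWeight, if_neg (by omega), if_neg (by omega), if_neg (by omega)]
      congr 1; omega
    rw [e0, e1, e2, e3, primedSeries, primedFactor]
    simp only [mul_assoc]

/-- The weights of the letters of symplectic tableaux, by rank. -/
def weight (x xb : ℕ → R) (r : ℕ) : R :=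
  if r % 2 = 0 then xb (r / 2) else x (r / 2)

/-- The contribution of the letters `k̄, k` to the generating function. -/
noncomputable def factor (x xb : ℕ → R) (k : ℕ) : PowerSeries R :=
  geom (xb k) * geom (x k)

/-- The rows of the determinant of the generating function of symplectic tableaux. -/
noncomputable def series (x xb : ℕ → R) : (k : ℕ) → Fin k → PowerSeries R
  | 0 => Fin.elim0
  | k + 1 => fun i =>
    Fin.snoc (α := fun _ => PowerSeries R) (fun j => PowerSeries.X * series x xb k j) 1 i *
      factor x xb k

theorem isTopAllowed_symplectic {m s : ℕ} (hs : s < 2) (a : Fin (m + 1) → ℕ) :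
    IsTopAllowed m a fun c => c.1 ≤ (2 * m + s) / 2 := by
  intro c hc
  obtain ⟨i, h1, h2, h3⟩ := mem_cells.1 hc
  have := i.2
  omega

/-- The offset k - 1 turns the strict sequence a into the ordinary diagram with row lengths a i - (k
- 1 - i), and the rule on the rows of a letter again empties row k before the letters of index k are
added. -/
theorem genFun_symplectic (x xb : ℕ → R) (k : ℕ) (a : Fin k → ℕ) (ha : StrictAnti a) :
    genFun (fun _ => False) (fun r c => c.1 ≤ r / 2)
      (weight x xb) (2 * k) (cells (k - 1) a) = coeffDet (series x xb k) a := by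
  induction k with
  | zero => rw [genFun_cells_zero, coeffDet, Matrix.det_isEmpty]
  | succ k ih =>
    have h0 : ∀ a : Fin (k + 1) → ℕ, StrictAnti a →
        genFun (fun _ => False) (fun r c => c.1 ≤ r / 2)
          (weight x xb) (2 * k) (cells k a) =
        coeffDet (Fin.snoc (α := fun _ => PowerSeries R)
          (fun j => PowerSeries.X * series x xb k j) 1) a := by
      intro a ha
      rw [coeffDet_snoc_one _ ha]
      split_ifs with h
      -- Deleting the empty last row lowers the offset from k to k - 1, so the same cells belong to
      -- the sequence with every part reduced by one; this produces the factor X in `series`.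
      · rw [coeffDet_X_mul _ (StrictAnti.castSucc_pos ha), ← ih]
        · congr 1
          ext c
          simp only [mem_cells, Fin.exists_fin_succ', h, Fin.val_castSucc, Fin.val_last]
          constructor
          · rintro (⟨i, h1, h2, h3⟩ | ⟨h1, h2, h3⟩)
            · have := i.2
              exact ⟨i, h1, by omega, by omega⟩
            · omega
          · rintro ⟨i, h1, h2, h3⟩
            have := i.2
            have := StrictAnti.castSucc_pos ha i
            exact Or.inl ⟨i, h1, by omega, by omega⟩
        · intro i j hij
          have h1 := ha (Fin.castSucc_lt_castSucc_iff.2 hij)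
          have h2 := StrictAnti.castSucc_pos ha j
          simp only
          omega
      · refine genFun_eq_zero (c := (k, 0)) (mem_cells.2 ⟨Fin.last k, rfl, ?_⟩) ?_
        · simp only [Fin.val_last]
          omega
        · intro r hr hcon
          simp only at hcon
          omega
    have h1 := genFun_succ_eq_coeffDet_of_not le_rfl (by simp)
      (isTopAllowed_symplectic (s := 0) (by omega)) h0
    have h2 := genFun_succ_eq_coeffDet_of_not le_rfl (by simp)
      (isTopAllowed_symplectic (s := 1) (by omega)) h1
    rw [show 2 * (k + 1) = 2 * k + 1 + 1 by ring, Nat.add_sub_cancel, h2 a ha]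
    congr 1
    ext1 i
    have e0 : weight x xb (2 * k) = xb k := by
      rw [weight, if_pos (by omega)]
      congr 1; omega
    have e1 : weight x xb (2 * k + 1) = x k := by
      rw [weight, if_neg (by omega)]
      congr 1; omega
    rw [e0, e1, series, factor]
    simp only [mul_assoc]

/-! ### Newton interpolation and the factorization of the determinant -/

theorem primedSeries_eq (x xb y yb : ℕ → R) (n : ℕ) (i : Fin n) :
    primedSeries x xb y yb n i = ∏ k ∈ Finset.Ico (i : ℕ) n, primedFactor x xb y yb k := by
  induction n with
  | zero => exact i.elim0
  | succ n ih =>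
    rw [primedSeries, Finset.prod_Ico_succ_top (Nat.lt_succ_iff.1 i.2)]
    refine Fin.lastCases ?_ (fun j => ?_) i
    · simp
    · simp [ih]

theorem series_eq (x xb : ℕ → R) (n : ℕ) (i : Fin n) :
    PowerSeries.X * series x xb n i =
      PowerSeries.X ^ (n - i) * ∏ k ∈ Finset.Ico (i : ℕ) n, factor x xb k := by
  induction n with
  | zero => exact i.elim0
  | succ n ih =>
    rw [series, Finset.prod_Ico_succ_top (Nat.lt_succ_iff.1 i.2), ← mul_assoc, ← mul_assoc]
    congr 1
    refine Fin.lastCases ?_ (fun j => ?_) i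
    · simp
    · have := j.2
      rw [Fin.snoc_castSucc, ih, Fin.val_castSucc, show n + 1 - (j : ℕ) = n - j + 1 by omega,
        pow_succ']
      ring

/-- The coefficients of the expansion of `∏ k < d, (W + Y k)` in terms of the products
`∏ k < j, (W - X k)`. -/
def newtonCoeff (X Y : ℕ → R) : ℕ → ℕ → R
  | 0, 0 => 1
  | 0, _ + 1 => 0
  | d + 1, 0 => (X 0 + Y d) * newtonCoeff X Y d 0
  | d + 1, j + 1 => newtonCoeff X Y d j + (X (j + 1) + Y d) * newtonCoeff X Y d (j + 1)

theorem newtonCoeff_of_lt (X Y : ℕ → R) {d j : ℕ} (h : d < j) : newtonCoeff X Y d j = 0 := by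
  induction d generalizing j with
  | zero =>
    obtain ⟨j, rfl⟩ : ∃ i, j = i + 1 := ⟨j - 1, by omega⟩
    rw [newtonCoeff]
  | succ d ih =>
    obtain ⟨j, rfl⟩ : ∃ i, j = i + 1 := ⟨j - 1, by omega⟩
    rw [newtonCoeff, ih (by omega), ih (by omega), mul_zero, add_zero]

theorem newtonCoeff_self (X Y : ℕ → R) (d : ℕ) : newtonCoeff X Y d d = 1 := by
  induction d with
  | zero => rw [newtonCoeff]
  | succ d ih => rw [newtonCoeff, ih, newtonCoeff_of_lt _ _ (Nat.lt_succ_self d), mul_zero, add_zero]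

theorem newtonCoeff_zero (X Y : ℕ → R) (d : ℕ) :
    newtonCoeff X Y d 0 = ∏ k ∈ Finset.range d, (X 0 + Y k) := by
  induction d with
  | zero => rw [newtonCoeff, Finset.prod_range_zero]
  | succ d ih => rw [newtonCoeff, ih, Finset.prod_range_succ, mul_comm]

/-- Newton interpolation, in a homogeneous form: `u` and `s` are the homogeneous coordinates. -/
theorem prod_add_eq_sum_newtonCoeff {A : Type*} [CommRing A] (X Y : ℕ → A) (u s : A) (d : ℕ) :
    ∏ k ∈ Finset.range d, (s + Y k * u) =
      ∑ j ∈ Finset.range (d + 1), newtonCoeff X Y d j *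
        (u ^ (d - j) * ∏ k ∈ Finset.range j, (s - X k * u)) := by
  induction d with
  | zero => simp [newtonCoeff]
  | succ d ih =>
    -- The new factor is split, differently in each term, as s + Y d * u = (s - X j * u) + (X j + Y
    -- d) * u.
    have step : ∀ j ∈ Finset.range (d + 1), newtonCoeff X Y d j *
        (u ^ (d - j) * ∏ k ∈ Finset.range j, (s - X k * u)) * (s + Y d * u) =
        newtonCoeff X Y d j *
          (u ^ (d - j) * ∏ k ∈ Finset.range (j + 1), (s - X k * u)) +
        (X j + Y d) * newtonCoeff X Y d j *
          (u ^ (d + 1 - j) * ∏ k ∈ Finset.range j, (s - X k * u)) := by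
      intro j hj
      have := Finset.mem_range.1 hj
      rw [Finset.prod_range_succ, show d + 1 - j = d - j + 1 by omega, pow_succ]
      ring
    rw [Finset.prod_range_succ, ih, Finset.sum_mul, Finset.sum_congr rfl step,
      Finset.sum_add_distrib, Finset.sum_range_succ' _ (d + 1),
      Finset.sum_range_succ' (fun j => (X j + Y d) * newtonCoeff X Y d j * _)]
    -- This vanishing term extends the second sum so that both sums run over the same range.
    have last : (X (d + 1) + Y d) * newtonCoeff X Y d (d + 1) *
        (u ^ (d + 1 - (d + 1)) * ∏ k ∈ Finset.range (d + 1), (s - X k * u)) = 0 := by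
      rw [newtonCoeff_of_lt _ _ (Nat.lt_succ_self d)]
      ring
    rw [← add_zero (∑ j ∈ Finset.range d, _), ← last,
      ← Finset.sum_range_succ (fun j => (X (j + 1) + Y d) * newtonCoeff X Y d (j + 1) *
        (u ^ (d + 1 - (j + 1)) * ∏ k ∈ Finset.range (j + 1), (s - X k * u))), ← add_assoc,
      ← Finset.sum_add_distrib]
    congr 1
    · refine Finset.sum_congr rfl fun j _ => ?_
      rw [newtonCoeff, Nat.add_sub_add_right]
      ring

theorem map_newtonCoeff {A : Type*} [CommRing A] (f : R →+* A) (X Y : ℕ → R) (d j : ℕ) :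
    f (newtonCoeff X Y d j) = newtonCoeff (fun k => f (X k)) (fun k => f (Y k)) d j := by
  induction d generalizing j with
  | zero => cases j <;> simp [newtonCoeff]
  | succ d ih => cases j <;> simp [newtonCoeff, ih]

theorem factor_mul {x xb : ℕ → R} {t : R} {k : ℕ} (hx : x k * xb k = t) :
    factor x xb k * (1 + PowerSeries.C t * PowerSeries.X ^ 2 -
      PowerSeries.C (x k + xb k) * PowerSeries.X) = 1 := by
  have h1 := geom_mul_one_sub (x k)
  have h2 := geom_mul_one_sub (xb k)
  rw [factor, ← hx, map_mul, map_add]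
  calc _ = (geom (x k) * (1 - PowerSeries.C (x k) * PowerSeries.X)) *
        (geom (xb k) * (1 - PowerSeries.C (xb k) * PowerSeries.X)) := by ring
    _ = 1 := by rw [h1, h2, mul_one]

/-- The numerator contains the same 1 + tX² as the denominator in `factor_mul`; the common value t
is what makes both linear in a single variable. -/
theorem primedFactor_eq {x xb y yb : ℕ → R} {t : R} {k : ℕ} (hy : y k * yb k = t) :
    primedFactor x xb y yb k = (1 + PowerSeries.C t * PowerSeries.X ^ 2 +
      PowerSeries.C (y k + yb k) * PowerSeries.X) * factor x xb k := by
  rw [primedFactor, factor, ← hy, map_mul, map_add]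
  ring

/-- Newton interpolation with u = X and s = 1 + tX². The j-th Newton product cancels the first j
factors of the denominator, leaving X times the symplectic series of index l = i + j, and the top
term j = n - i leaves the constant 1. -/
theorem primedSeries_eq_sum {x xb y yb : ℕ → R} {t : R} {n : ℕ} (hx : ∀ k < n, x k * xb k = t)
    (hy : ∀ k < n, y k * yb k = t) (i : Fin n) :
    primedSeries x xb y yb n i = 1 + ∑ l : Fin n,
      PowerSeries.C (if i ≤ l then newtonCoeff (fun k => x (i + k) + xb (i + k))
        (fun k => y (i + k) + yb (i + k)) (n - i) (l - i) else 0) *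
      (PowerSeries.X * series x xb n l) := by
  set s : PowerSeries R := 1 + PowerSeries.C t * PowerSeries.X ^ 2 with hs
  set d := n - (i : ℕ) with hd
  have hi := i.2
  have cancel : ∀ j ≤ d,
      (∏ k ∈ Finset.range j, (s - PowerSeries.C (x (i + k) + xb (i + k)) * PowerSeries.X)) *
        ∏ k ∈ Finset.range d, factor x xb (i + k) =
      ∏ k ∈ Finset.Ico j d, factor x xb (i + k) := by
    intro j hj
    rw [← Finset.prod_range_mul_prod_Ico _ hj, ← mul_assoc, ← Finset.prod_mul_distrib,
      Finset.prod_eq_one, one_mul]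
    intro k hk
    have := Finset.mem_range.1 hk
    rw [mul_comm]
    exact factor_mul (hx _ (by omega))
  rw [primedSeries_eq, Finset.prod_Ico_eq_prod_range,
    Finset.prod_congr rfl (g := fun k =>
      (s + PowerSeries.C (y (i + k) + yb (i + k)) * PowerSeries.X) * factor x xb (i + k)),
    Finset.prod_mul_distrib,
    prod_add_eq_sum_newtonCoeff (fun k => PowerSeries.C (x (i + k) + xb (i + k))),
    Finset.sum_mul, Finset.sum_range_succ, add_comm]
  · congr 1
    · rw [newtonCoeff_self, Nat.sub_self, pow_zero, one_mul, one_mul, cancel _ le_rfl,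
        Finset.Ico_self, Finset.prod_empty]
    · rw [Finset.sum_congr rfl (g := fun l : Fin n => if (i : ℕ) ≤ l then
        PowerSeries.C (newtonCoeff (fun k => x (i + k) + xb (i + k))
          (fun k => y (i + k) + yb (i + k)) d (l - i)) *
        (PowerSeries.X ^ (n - l) * ∏ k ∈ Finset.Ico (l : ℕ) n, factor x xb k) else 0),
        Fin.sum_univ_eq_sum_range (fun l => if (i : ℕ) ≤ l then
        PowerSeries.C (newtonCoeff (fun k => x (i + k) + xb (i + k))
          (fun k => y (i + k) + yb (i + k)) d (l - i)) *
        (PowerSeries.X ^ (n - l) * ∏ k ∈ Finset.Ico (l : ℕ) n, factor x xb k) else 0) n,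
        ← Finset.sum_filter]
      · have : (Finset.range n).filter (fun l => (i : ℕ) ≤ l) = Finset.Ico (i : ℕ) n := by
          ext; simp [and_comm]
        rw [this, Finset.sum_Ico_eq_sum_range]
        refine Finset.sum_congr rfl fun j hj => ?_
        have := Finset.mem_range.1 hj
        rw [mul_assoc, mul_assoc, cancel j this.le, map_newtonCoeff, Nat.add_sub_cancel_left,
          Finset.prod_Ico_eq_prod_range _ (i + j) n, Finset.prod_Ico_eq_prod_range _ j d,
          show n - (i + j) = d - j by omega]
        simp only [add_assoc, hd]
      · intro l _
        rw [series_eq]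
        simp only [Fin.le_def]
        split_ifs <;> simp
  · intro k hk
    have := Finset.mem_range.1 hk
    exact primedFactor_eq (hy _ (by omega))

/-- At positive exponents the constant 1 has coefficient zero, so the coefficient matrix is the
symplectic one times a lower triangular matrix of Newton coefficients. -/
theorem coeffDet_primedSeries {x xb y yb : ℕ → R} {t : R} {n : ℕ} (hx : ∀ k < n, x k * xb k = t)
    (hy : ∀ k < n, y k * yb k = t) {a : Fin n → ℕ} (ha : ∀ j, 0 < a j) :
    coeffDet (primedSeries x xb y yb n) a =
      (∏ i : Fin n, ∏ k ∈ Finset.Ico (i : ℕ) n, (x i + xb i + (y k + yb k))) *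
        coeffDet (series x xb n) fun j => a j - 1 := by
  set M : Matrix (Fin n) (Fin n) R := Matrix.of fun l i =>
    if i ≤ l then newtonCoeff (fun k => x (i + k) + xb (i + k))
      (fun k => y (i + k) + yb (i + k)) (n - i) (l - i) else 0 with hM
  have hdet : M.det =
      ∏ i : Fin n, ∏ k ∈ Finset.Ico (i : ℕ) n, (x i + xb i + (y k + yb k)) := by
    rw [Matrix.det_of_isLowerTriangular M]
    · refine Finset.prod_congr rfl fun i _ => ?_
      rw [hM, Matrix.of_apply, if_pos le_rfl, Nat.sub_self, newtonCoeff_zero,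
        Finset.prod_Ico_eq_prod_range]
      simp
    · intro i j hij
      have : ¬ j ≤ i := not_le.2 hij
      simp [hM, this]
  rw [← coeffDet_X_mul _ ha, ← hdet, mul_comm, coeffDet, coeffDet, ← Matrix.det_mul]
  congr 1
  ext j i
  rw [Matrix.of_apply, primedSeries_eq_sum hx hy, Matrix.mul_apply]
  simp only [map_add, map_sum, PowerSeries.coeff_C_mul, Matrix.of_apply, hM]
  rw [PowerSeries.coeff_one, if_neg (ha j).ne', zero_add]
  exact Finset.sum_congr rfl fun l _ => mul_comm _ _

/-! ### Translation of tableaux into numberings by ranks -/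

instance Letter.instFintype (n : ℕ) : Fintype (Letter n) :=
  Fintype.ofEquiv (Fin n × Bool)
    ⟨fun p => ⟨p.1, p.2⟩, fun a => (a.index, a.barred), fun _ => rfl, fun _ => rfl⟩

instance PrimedLetter.instFintype (n : ℕ) : Fintype (PrimedLetter n) :=
  Fintype.ofEquiv (Fin n × Bool × Bool)
    ⟨fun p => ⟨p.1, p.2.1, p.2.2⟩, fun a => (a.index, a.barred, a.primed), fun _ => rfl,
      fun _ => rfl⟩

theorem Letter.exists_rank_eq {n r : ℕ} : (∃ a : Letter n, a.rank = r) ↔ r < 2 * n := by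
  constructor
  · rintro ⟨⟨i, b⟩, rfl⟩
    have := i.2
    cases b <;> simp [Letter.rank] <;> omega
  · intro h
    refine ⟨⟨⟨r / 2, by omega⟩, r % 2 = 0⟩, ?_⟩
    simp only [Letter.rank, decide_eq_true_eq]
    split_ifs <;> omega

theorem PrimedLetter.exists_rank_eq {n r : ℕ} :
    (∃ a : PrimedLetter n, a.rank = r) ↔ r < 4 * n := by
  constructor
  · rintro ⟨⟨i, b, p⟩, rfl⟩
    have := i.2
    cases b <;> cases p <;> simp [PrimedLetter.rank] <;> omega
  · intro h
    refine ⟨⟨⟨r / 4, by omega⟩, r % 4 < 2, r % 2 = 0⟩, ?_⟩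
    simp only [PrimedLetter.rank, decide_eq_true_eq]
    split_ifs <;> omega

theorem Letter.rank_div_two {n : ℕ} (a : Letter n) : a.rank / 2 = a.index := by
  rcases a with ⟨i, b⟩
  cases b <;> simp [Letter.rank]; omega

theorem PrimedLetter.rank_div_four {n : ℕ} (a : PrimedLetter n) : a.rank / 4 = a.index := by
  rcases a with ⟨i, b, p⟩
  cases b <;> cases p <;> simp [PrimedLetter.rank] <;> omega

theorem PrimedLetter.rank_mod_two {n : ℕ} (a : PrimedLetter n) :
    a.rank % 2 = 0 ↔ a.primed = true := by
  rcases a with ⟨i, b, p⟩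
  cases b <;> cases p <;> simp [PrimedLetter.rank] <;> omega

open Classical in
theorem sum_eq_genFun {L : Type*} [Fintype L] {rank : L → ℕ} (hinj : Function.Injective rank)
    {N : ℕ} (hN : ∀ {r}, (∃ l, rank l = r) ↔ r < N) {pr : ℕ → Prop} {ok : ℕ → ℕ × ℕ → Prop}
    (w : ℕ → R) {D : Finset (ℕ × ℕ)} {P : (D → L) → Prop}
    (hP : ∀ S, P S ↔ IsAdmissible pr ok fun c => rank (S c)) :
    ∑ S ∈ Finset.univ.filter P, ∏ c, w (rank (S c)) = genFun pr ok w N D := by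
  refine Finset.sum_bij (fun S _ c => rank (S c)) ?_ ?_ ?_ ?_
  · intro S hS
    rw [Finset.mem_filter] at hS
    exact mem_admissible.2 ⟨fun c => hN.1 ⟨_, rfl⟩, (hP S).1 hS.2⟩
  · intro S _ S' _ h
    ext c
    exact hinj (congrFun h c)
  · intro f hf
    obtain ⟨h1, h2⟩ := mem_admissible.1 hf
    choose S hS using fun c => hN.2 (h1 c)
    have hSf : (fun c => rank (S c)) = f := funext hS
    exact ⟨S, Finset.mem_filter.2 ⟨Finset.mem_univ _, (hP S).2 (hSf ▸ h2)⟩, hSf⟩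
  · intro S _
    rfl

theorem isSymplecticTableau_iff {n : ℕ} {D : Finset (ℕ × ℕ)} (S : D → Letter n) :
    IsSymplecticTableau S ↔
      IsAdmissible (fun _ => False) (fun r c => c.1 ≤ r / 2) fun c => (S c).rank := by
  constructor
  · intro h
    exact ⟨fun c d h1 h2 => ⟨h.row_weak c d h1 h2, False.elim⟩,
      fun c d h1 h2 => ⟨(h.col_strict c d h1 h2).le, fun _ he =>
        (h.col_strict c d h1 h2).ne (Letter.rank_injective he)⟩,
      fun c => by
        rw [Letter.rank_div_two]
        exact h.row_le_index c⟩
  · intro h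
    exact ⟨fun c d h1 h2 => (h.row c d h1 h2).1,
      fun c d h1 h2 => lt_of_le_of_ne (h.col c d h1 h2).1 fun he =>
        (h.col c d h1 h2).2 not_false (congrArg _ he),
      fun c => by
        rw [← Letter.rank_div_two]
        exact h.ok c⟩

theorem isPrimedShiftedSymplecticTableau_iff {n : ℕ} {D : Finset (ℕ × ℕ)}
    (S : D → PrimedLetter n) :
    IsPrimedShiftedSymplecticTableau S ↔
      IsAdmissible (fun r => r % 2 = 0) (fun r c => c.1 = c.2 → r / 4 = c.1)
        fun c => (S c).rank := by
  have hne : ∀ {c d : D}, (S c).rank ≠ (S d).rank ↔ S c ≠ S d :=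
    PrimedLetter.rank_injective.ne_iff
  constructor
  · intro h
    refine ⟨fun c d h1 h2 => ⟨h.row_weak c d h1 h2, fun hp => ?_⟩,
      fun c d h1 h2 => ⟨h.col_weak c d h1 h2, fun hp => ?_⟩, fun c hc => ?_⟩
    · rw [PrimedLetter.rank_mod_two] at hp
      exact hne.2 (h.row_primed c d h1 (fun he => by rw [he] at h2; omega) hp)
    · rw [PrimedLetter.rank_mod_two, Bool.not_eq_true] at hp
      exact hne.2 (h.col_unprimed c d h1 (fun he => by rw [he] at h2; omega) hp)
    · rw [PrimedLetter.rank_div_four]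
      exact h.diag c hc
  · intro h
    refine ⟨fun c d h1 h2 => (h.row c d h1 h2).1, fun c d h1 h2 => (h.col c d h1 h2).1,
      fun c d h1 hcd hp he => ?_, fun c d h1 hcd hp he => ?_, fun c hc => ?_⟩
    · have key : ∀ c : D, (S c).primed = false → ¬ (S c).rank % 2 = 0 := fun c hp => by
        rw [PrimedLetter.rank_mod_two, hp]
        simp
      rcases lt_trichotomy c.1.1 d.1.1 with h2 | h2 | h2
      · exact (h.col c d h1 h2).2 (key c hp) (congrArg _ he)
      · exact hcd (Subtype.ext (Prod.ext h2 h1))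
      · exact (h.col d c h1.symm h2).2 (key d (he ▸ hp)) (congrArg _ he.symm)
    · rcases lt_trichotomy c.1.2 d.1.2 with h2 | h2 | h2
      · exact (h.row c d h1 h2).2 ((PrimedLetter.rank_mod_two _).2 hp) (congrArg _ he)
      · exact hcd (Subtype.ext (Prod.ext h1 h2))
      · exact (h.row d c h1.symm h2).2 ((PrimedLetter.rank_mod_two _).2 (he ▸ hp))
          (congrArg _ he.symm)
    · rw [← PrimedLetter.rank_div_four]
      exact h.ok c hc

theorem shiftedDiagram_eq_cells {n : ℕ} (mu : Fin n → ℕ) : shiftedDiagram mu = cells 0 mu := by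
  simp only [shiftedDiagram, cells, Nat.sub_zero, add_comm]

/-- Every row index is at most n - 1, so the left ends truncate to column 0 and the offset n - 1
undoes the staircase. -/
theorem diagram_eq_cells {n : ℕ} (lam : Fin n → ℕ) :
    diagram lam = cells (n - 1) fun i => lam i + staircase n i - 1 := by
  rw [diagram, cells]
  congr 1
  ext1 i
  have := i.2
  rw [Finset.range_eq_Ico]
  congr 2
  · omega
  · simp only [staircase]
    omega

theorem strictAnti_add_staircase {n : ℕ} {lam : Fin n → ℕ} (hlam : Antitone lam) :
    StrictAnti (lam + staircase n) := by
  intro i j hij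
  have := hlam hij.le
  have := j.2
  have := Fin.lt_def.1 hij
  simp only [Pi.add_apply, staircase]
  omega

theorem pos_add_staircase {n : ℕ} (lam : Fin n → ℕ) (i : Fin n) : 0 < (lam + staircase n) i := by
  have := i.2
  simp only [Pi.add_apply, staircase]
  omega

/-! ### Generating functions of the three sets -/

open Classical in
theorem sum_QST (x xb y yb : ℕ → R) {n : ℕ} {mu : Fin n → ℕ} (hmu : StrictAnti mu) :
    ∑ S : QST n mu, ∏ c, primedWeight x xb y yb (S.1 c).rank =
      coeffDet (primedSeries x xb y yb n) mu := by
  rw [← genFun_primed _ _ _ _ _ _ hmu, ← shiftedDiagram_eq_cells,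
    ← sum_eq_genFun PrimedLetter.rank_injective PrimedLetter.exists_rank_eq _
      isPrimedShiftedSymplecticTableau_iff]
  exact (Finset.sum_subtype (f := fun S : shiftedDiagram mu → PrimedLetter n =>
    ∏ c, primedWeight x xb y yb (S c).rank) _
    (fun S => by rw [Finset.mem_filter]; exact and_iff_right (Finset.mem_univ _))).symm

open Classical in
theorem sum_T (x xb : ℕ → R) {n : ℕ} {lam : Fin n → ℕ} (hlam : Antitone lam) :
    ∑ S : T n lam, ∏ c, weight x xb (S.1 c).rank =
      coeffDet (series x xb n) fun i => (lam + staircase n) i - 1 := by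
  have hanti : StrictAnti fun i => (lam + staircase n) i - 1 := fun i j hij => by
    have h1 := strictAnti_add_staircase hlam hij
    have h2 := pos_add_staircase lam j
    simp only
    omega
  rw [← genFun_symplectic _ _ _ _ hanti]
  simp only [Pi.add_apply]
  rw [← diagram_eq_cells,
    ← sum_eq_genFun Letter.rank_injective Letter.exists_rank_eq _ isSymplecticTableau_iff]
  exact (Finset.sum_subtype (f := fun S : diagram lam → Letter n =>
    ∏ c, weight x xb (S c).rank) _
    (fun S => by rw [Finset.mem_filter]; exact and_iff_right (Finset.mem_univ _))).symm

theorem primedWeight_rank {A : Type*} (x xb y yb : ℕ → A) {n : ℕ} (a : PrimedLetter n) :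
    primedWeight x xb y yb a.rank =
      if a.primed then (if a.barred then yb a.index else y a.index)
      else (if a.barred then xb a.index else x a.index) := by
  have h := a.rank_div_four
  rw [primedWeight, h]
  rcases a with ⟨i, b, p⟩
  cases b <;> cases p <;> simp only [PrimedLetter.rank] <;>
    simp [Nat.add_mod]

theorem weight_rank {A : Type*} (x xb : ℕ → A) {n : ℕ} (a : Letter n) :
    weight x xb a.rank = if a.barred then xb a.index else x a.index := by
  have h := a.rank_div_two
  rw [weight, h]
  rcases a with ⟨i, b⟩
  cases b <;> simp only [Letter.rank] <;> simp [Nat.add_mod]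

/-- The letters that a primed numbering of the shifted staircase may have in a given cell. -/
def cellLetters (n : ℕ) (c : ℕ × ℕ) : Finset (PrimedLetter n) :=
  Finset.univ.filter fun a =>
    (a.primed = false → (a.index : ℕ) = c.1) ∧ (a.primed = true → (a.index : ℕ) = c.2)

theorem sum_cellLetters (x xb y yb : ℕ → R) {n : ℕ} (i j : Fin n) :
    ∑ a ∈ cellLetters n (i, j), primedWeight x xb y yb a.rank =
      x i + xb i + (y j + yb j) := by
  have : cellLetters n (i, j) =
      {⟨i, false, false⟩, ⟨i, true, false⟩, ⟨j, false, true⟩, ⟨j, true, true⟩} := by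
    ext ⟨l, b, p⟩
    cases b <;> cases p <;> simp [cellLetters, Fin.ext_iff]
  rw [this, Finset.sum_insert (by simp), Finset.sum_insert (by simp), Finset.sum_insert (by simp),
    Finset.sum_singleton]
  simp only [primedWeight_rank]
  simp
  ring

-- The conditions are imposed cell by cell, so the sum is a product over cells, and cell (i, k)
-- admits just i, ī, k', k̄'.
open Classical in
theorem sum_QD (x xb y yb : ℕ → R) (n : ℕ) :
    ∑ P : QD n, ∏ c, primedWeight x xb y yb (P.1 c).rank =
      ∏ i : Fin n, ∏ k ∈ Finset.Ico (i : ℕ) n, (x i + xb i + (y k + yb k)) := by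
  have h1 : ∑ P : QD n, ∏ c, primedWeight x xb y yb (P.1 c).rank =
      ∑ P ∈ Fintype.piFinset fun c : shiftedDiagram (staircase n) => cellLetters n c.1,
        ∏ c, primedWeight x xb y yb (P c).rank :=
    (Finset.sum_subtype (f := fun P : shiftedDiagram (staircase n) → PrimedLetter n =>
      ∏ c, primedWeight x xb y yb (P c).rank) _
      (fun P => by
        rw [Fintype.mem_piFinset]
        simp only [cellLetters, Finset.mem_filter, Finset.mem_univ, true_and]
        rfl)).symm
  rw [h1, ← Finset.prod_univ_sum (f := fun _ a => primedWeight x xb y yb (PrimedLetter.rank a)),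
    Finset.prod_coe_sort (shiftedDiagram (staircase n))
      (fun c => ∑ a ∈ cellLetters n c, primedWeight x xb y yb a.rank),
    shiftedDiagram, Finset.prod_biUnion]
  · refine Finset.prod_congr rfl fun i _ => ?_
    have hi := i.2
    rw [Finset.prod_image (fun _ _ _ _ h => (Prod.mk.inj h).2), staircase,
      show (i : ℕ) + (n - i) = n by omega]
    refine Finset.prod_congr rfl fun k hk => ?_
    exact sum_cellLetters x xb y yb i ⟨k, (Finset.mem_Ico.1 hk).2⟩
  · intro i _ j _ hij
    rw [Function.onFun, Finset.disjoint_left]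
    intro c hc hc'
    obtain ⟨k, -, rfl⟩ := Finset.mem_image.1 hc
    obtain ⟨l, -, h⟩ := Finset.mem_image.1 hc'
    exact hij (Fin.ext (Prod.mk.inj h).1.symm)

open Classical in
/-- The generating function of the primed shifted symplectic tableaux is the product of those of
the primed numberings of the shifted staircase and of the symplectic tableaux. -/
theorem sum_QST_eq {x xb y yb : ℕ → R} {t : R} {n : ℕ} (hx : ∀ k < n, x k * xb k = t)
    (hy : ∀ k < n, y k * yb k = t) {lam : Fin n → ℕ} (hlam : Antitone lam) :
    ∑ S : QST n (lam + staircase n), ∏ c, primedWeight x xb y yb (S.1 c).rank =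
      (∑ P : QD n, ∏ c, primedWeight x xb y yb (P.1 c).rank) *
        ∑ S : T n lam, ∏ c, weight x xb (S.1 c).rank := by
  rw [sum_QST _ _ _ _ (strictAnti_add_staircase hlam), sum_QD, sum_T _ _ hlam,
    coeffDet_primedSeries hx hy (pos_add_staircase lam)]

/-! ### From the identity in the group algebra to a bijection -/

/-- The weight and the number of barred entries of a numbering by a single letter. -/
def letterStat {n : ℕ} (a : PrimedLetter n) : ((Fin n → ℤ) × (Fin n → ℤ)) × ℤ :=
  ((if a.primed then 0 else Pi.single a.index (if a.barred then -1 else 1),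
    if a.primed then Pi.single a.index (if a.barred then -1 else 1) else 0),
    if a.barred then 1 else 0)

theorem count_eq_sum {A : Type} [DecidableEq A] {D : Finset (ℕ × ℕ)} (f : D → A) (a : A) :
    (count f a : ℤ) = ∑ c, if f c = a then 1 else 0 := by
  rw [count, Finset.card_filter]
  push_cast
  rfl

theorem sum_letterStat {n : ℕ} {D : Finset (ℕ × ℕ)} (f : D → PrimedLetter n) :
    ∑ c, letterStat (f c) = (primedWgt f, (primedBar f : ℤ)) := by
  refine Prod.ext (Prod.ext ?_ ?_) ?_
  · ext k
    simp only [primedWgt, Prod.fst_sum, Finset.sum_apply, count_eq_sum, ← Finset.sum_sub_distrib]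
    refine Finset.sum_congr rfl fun c _ => ?_
    rcases f c with ⟨i, b, p⟩
    cases b <;> cases p <;> simp [letterStat, Pi.single_apply, eq_comm, apply_ite]
  · ext k
    simp only [primedWgt, Prod.fst_sum, Prod.snd_sum, Finset.sum_apply, count_eq_sum,
      ← Finset.sum_sub_distrib]
    refine Finset.sum_congr rfl fun c _ => ?_
    rcases f c with ⟨i, b, p⟩
    cases b <;> cases p <;> simp [letterStat, Pi.single_apply, eq_comm, apply_ite]
  · rw [Prod.snd_sum, primedBar, Finset.card_filter]
    push_cast
    rfl

theorem sum_letterStat_unprimed {n : ℕ} {D : Finset (ℕ × ℕ)} (f : D → Letter n) :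
    ∑ c, letterStat ⟨(f c).index, (f c).barred, false⟩ = ((wgt f, 0), (bar f : ℤ)) := by
  refine Prod.ext (Prod.ext ?_ ?_) ?_
  · ext k
    simp only [wgt, Prod.fst_sum, Finset.sum_apply, count_eq_sum, ← Finset.sum_sub_distrib]
    refine Finset.sum_congr rfl fun c _ => ?_
    rcases f c with ⟨i, b⟩
    cases b <;> simp [letterStat, Pi.single_apply, eq_comm, apply_ite]
  · simp [letterStat, Prod.fst_sum, Prod.snd_sum]
  · rw [Prod.snd_sum, bar, Finset.card_filter]
    push_cast
    rfl

-- The coefficient at each v counts the fibre over v, so the fibres are equinumerous and chosen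
-- bijections between them glue.
open Classical in
theorem exists_equiv_of_sum_single_eq {α β G : Type*} [Fintype α] [Fintype β] {f : α → G}
    {g : β → G}
    (h : ∑ a, AddMonoidAlgebra.single (f a) (1 : ℤ) = ∑ b, AddMonoidAlgebra.single (g b) (1 : ℤ)) :
    ∃ e : α ≃ β, ∀ a, g (e a) = f a := by
  have key : ∀ v, Nonempty ({a // f a = v} ≃ {b // g b = v}) := fun v => by
    have hv := DFunLike.congr_fun (congrArg AddMonoidAlgebra.coeff h) v
    simp only [AddMonoidAlgebra.coeff_sum, Finsupp.finsetSum_apply,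
      AddMonoidAlgebra.coeff_single, Finsupp.single_apply, Finset.sum_boole, Nat.cast_inj] at hv
    refine Fintype.card_eq.1 ?_
    rw [Fintype.card_subtype, Fintype.card_subtype]
    exact_mod_cast hv
  refine ⟨(Equiv.sigmaFiberEquiv f).symm.trans
    ((Equiv.sigmaCongrRight fun v => (key v).some).trans (Equiv.sigmaFiberEquiv g)), fun a => ?_⟩
  exact ((key (f a)).some ⟨a, rfl⟩).2

theorem prod_single {ι G : Type*} [AddCommMonoid G] (s : Finset ι) (f : ι → G) :
    ∏ i ∈ s, AddMonoidAlgebra.single (f i) (1 : ℤ) = AddMonoidAlgebra.single (∑ i ∈ s, f i) 1 := by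
  classical
  induction s using Finset.induction_on with
  | empty => simp [AddMonoidAlgebra.one_def]
  | insert i s hi ih =>
    rw [Finset.prod_insert hi, Finset.sum_insert hi, ih, AddMonoidAlgebra.single_mul_single,
      mul_one]

end SymplecticTableaux

open SymplecticTableaux in
theorem mainTheorem3 (n : ℕ) (lam mu : Fin n → ℕ) (hlam : Antitone lam)
    (hmu : mu = lam + SymplecticTableaux.staircase n) :
    ∃ Φ : SymplecticTableaux.QST n mu →
        SymplecticTableaux.QD n × SymplecticTableaux.T n lam,
      Function.Bijective Φ ∧
      ∀ S : SymplecticTableaux.QST n mu,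
        SymplecticTableaux.primedWgt S.1 =
          SymplecticTableaux.primedWgt (Φ S).1.1 + (SymplecticTableaux.wgt (Φ S).2.1, 0) ∧
        SymplecticTableaux.primedBar S.1 =
          SymplecticTableaux.primedBar (Φ S).1.1 + SymplecticTableaux.bar (Φ S).2.1 := by
  classical
  subst hmu
  -- The weights are sequences on ℕ; the value 0 from n on is a filler, since only indices below n
  -- occur.
  let v : Bool → Bool → ℕ → AddMonoidAlgebra ℤ (((Fin n → ℤ) × (Fin n → ℤ)) × ℤ) := fun b p k =>
    if h : k < n then AddMonoidAlgebra.single (letterStat ⟨⟨k, h⟩, b, p⟩) 1 else 0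
  have hv : ∀ b p (i : Fin n), v b p i = AddMonoidAlgebra.single (letterStat ⟨i, b, p⟩) 1 :=
    fun b p i => by simp [v, i.2]
  -- The weights of a letter and its barred partner cancel and one bar remains, so t is the same for
  -- every k and for both kinds of letters.
  have ht : ∀ p, ∀ k < n, v false p k * v true p k = AddMonoidAlgebra.single (0, 1) 1 := by
    intro p k hk
    have h1 := hv false p ⟨k, hk⟩
    have h2 := hv true p ⟨k, hk⟩
    simp only at h1 h2
    rw [h1, h2, AddMonoidAlgebra.single_mul_single, mul_one]
    congr 1
    cases p <;> simp [letterStat, ← Pi.single_add]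
  have hprimed : ∀ a : PrimedLetter n,
      primedWeight (v false false) (v true false) (v false true) (v true true) a.rank =
        AddMonoidAlgebra.single (letterStat a) 1 := by
    rintro ⟨i, b, p⟩
    rw [primedWeight_rank]
    cases b <;> cases p <;> simp [hv]
  have hunprimed : ∀ a : Letter n, weight (v false false) (v true false) a.rank =
      AddMonoidAlgebra.single (letterStat ⟨a.index, a.barred, false⟩) 1 := by
    rintro ⟨i, b⟩
    rw [weight_rank]
    cases b <;> simp [hv]
  have key := sum_QST_eq (ht false) (ht true) hlam
  simp only [hprimed, hunprimed, prod_single, sum_letterStat_unprimed] at key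
  simp only [sum_letterStat] at key
  rw [Fintype.sum_mul_sum, ← Fintype.sum_prod_type'] at key
  simp only [AddMonoidAlgebra.single_mul_single, mul_one] at key
  obtain ⟨e, he⟩ := exists_equiv_of_sum_single_eq key
  refine ⟨e, e.bijective, fun S => ?_⟩
  have h := he S
  have hbar : (primedBar S.1 : ℤ) = primedBar (e S).1.1 + bar (e S).2.1 :=
    (congrArg Prod.snd h).symm
  exact ⟨(congrArg Prod.fst h).symm, by exact_mod_cast hbar⟩
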